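/- Let $d>1$ be a cube-free integer, $L=\mathbb{Q}(\sqrt[3]{d})$ the corresponding pure cubic field, $\zeta_3$ a primitive cube root of unity, $k_0=\mathbb{Q}(\zeta_3)$, $k=\mathbb{Q}(\sqrt[3]{d},\zeta_3)$ the normal closure of $L$, and $G=\operatorname{Gal}(k/k_0)$. For a number field $F$ let $E_F$, $\mathcal{I}_F$ and $\mathcal{P}_F$ denote the unit group of the ring of integers $\mathcal{O}_F$, the group of nonzero fractional ideals and the group of nonzero principal fractional ideals of $F$; for $F\subseteq F'$ regard $\mathcal{I}_F$ as a subgroup of $\mathcal{I}_{F'}$ by extension of ideals. Let $\mathcal{P}_k^G$ be the group of $G$-invariant principal fractional ideals of $k$, and $\mathcal{P}_L^G$ the group of principal fractional ideals of $L$ whose extension to $k$ is $G$-invariant. Let $\ker(N_{k/L})\cap(\mathcal{P}_k^G/\mathcal{P}_{k_0})$ be the group of classes in $\mathcal{P}_k^G/\mathcal{P}_{k_0}$ of those ideals whose relative norm to $L$ lies in $\mathcal{I}_{\mathbb{Q}}$. Let $t$ be the number of prime ideals of $k_0$ that ramify in $k$, and let $2s$ be the number of those among them that lie over rational primes which split in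 $k_0/\mathbb{Q}$ (this number is even). Then there are integers $U,A,R\ge 0$ such that $$3^U=(E_{k_0}:N_{k/k_0}(E_k)),\qquad 3^A=\#(\mathcal{P}_L^G/\mathcal{P}_{\mathbb{Q}}),\qquad 3^R=\#\bigl(\ker(N_{k/L})\cap(\mathcal{P}_k^G/\mathcal{P}_{k_0})\bigr),$$ and $L$ belongs to precisely one of the following three principal factorization types: type $\alpha$, with $(U;A,R)=(1;1,1)$; type $\beta$, with $(U;A,R)=(1;2,0)$; type $\gamma$, with $(U;A,R)=(0;1,0)$. The invariants satisfy the equation $A+R=U+1$ and the estimates $1\le A+R\le t$, $1\le A\le t-s$ and $0\le R\le s$. For each type, the group $\mathcal{P}_L^G/\mathcal{P}_{\mathbb{Q}}$ contains the subgroup $\Delta$ generated by the class of the principal ideal $\sqrt[3]{d}\,\mathcal{O}_L$, and $\Delta$ has order $3$. -/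

import Mathlib

open scoped NumberField nonZeroDivisors

noncomputable section

namespace PureCubic

/-- `𝓘_F`: the group of nonzero fractional ideals of the number field `F`. -/
abbrev IdealGroup (F : Type*) [Field F] [NumberField F] : Type _ :=
  (FractionalIdeal (𝓞 F)⁰ F)ˣ

/-- `𝓟_F`: the group of nonzero principal fractional ideals of `F`. -/
abbrev principalIdeals (F : Type*) [Field F] [NumberField F] : Subgroup (IdealGroup F) :=
  (toPrincipalIdeal (𝓞 F) F).range

section Extension

variable (F E : Type*) [Field F] [NumberField F] [Field E] [NumberField E] [Algebra F E]

/-- Extension of ideals `𝓘_F → 𝓘_E`, `𝔞 ↦ 𝔞 𝓞_E`. -/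
def idealExt : IdealGroup F →* IdealGroup E :=
  Units.map (FractionalIdeal.extendedHom (A := 𝓞 F) (K := F) E (𝓞 E)).toMonoidHom

/-- `𝓘_F` regarded as a subgroup of `𝓘_E`. -/
def extendedIdeals : Subgroup (IdealGroup E) := (idealExt F E).range

/-- `𝓟_F` regarded as a subgroup of `𝓘_E`. -/
def extendedPrincipalIdeals : Subgroup (IdealGroup E) :=
  (principalIdeals F).map (idealExt F E)

/-- The norm of a fractional ideal `𝔞/b`, extending `Ideal.relNorm` multiplicatively. -/
def fracRelNormFun (I : FractionalIdeal (𝓞 E)⁰ E) : FractionalIdeal (𝓞 F)⁰ F :=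
  (Ideal.relNorm (𝓞 F) I.num : FractionalIdeal (𝓞 F)⁰ F) /
    (Ideal.relNorm (𝓞 F) (Ideal.span {(I.den : 𝓞 E)}) : FractionalIdeal (𝓞 F)⁰ F)

theorem mul_den_eq_num (I : FractionalIdeal (𝓞 E)⁰ E) :
    I * (Ideal.span {(I.den : 𝓞 E)} : Ideal (𝓞 E)) = (I.num : FractionalIdeal (𝓞 E)⁰ E) := by
  have h := FractionalIdeal.den_mul_self_eq_num' (𝓞 E)⁰ E I
  rw [← h, FractionalIdeal.coeIdeal_span_singleton, mul_comm]

/-- The norm does not depend on the way in which the ideal is written as a fraction. -/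
theorem fracRelNormFun_eq (I : FractionalIdeal (𝓞 E)⁰ E) (A B : Ideal (𝓞 E)) (hB : B ≠ ⊥)
    (h : I * (B : FractionalIdeal (𝓞 E)⁰ E) = A) :
    fracRelNormFun F E I = (Ideal.relNorm (𝓞 F) A : FractionalIdeal (𝓞 F)⁰ F) /
      (Ideal.relNorm (𝓞 F) B : FractionalIdeal (𝓞 F)⁰ F) := by
  have hden : Ideal.span {(I.den : 𝓞 E)} ≠ ⊥ := by
    simp
  have key : I.num * B = A * Ideal.span {(I.den : 𝓞 E)} := by
    apply FractionalIdeal.coeIdeal_injective (K := E)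
    simp only [FractionalIdeal.coeIdeal_mul]
    rw [← mul_den_eq_num, ← h]
    ring
  unfold fracRelNormFun
  rw [div_eq_div_iff]
  · rw [← FractionalIdeal.coeIdeal_mul, ← FractionalIdeal.coeIdeal_mul, ← map_mul, ← map_mul, key]
  · rw [Ne, FractionalIdeal.coeIdeal_eq_zero, Ideal.relNorm_eq_bot_iff]
    exact hden
  · rw [Ne, FractionalIdeal.coeIdeal_eq_zero, Ideal.relNorm_eq_bot_iff]
    exact hB

/-- The relative norm of fractional ideals as a homomorphism. -/
def fracRelNorm : FractionalIdeal (𝓞 E)⁰ E →* FractionalIdeal (𝓞 F)⁰ F where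
  toFun := fracRelNormFun F E
  map_one' := by
    rw [fracRelNormFun_eq F E 1 ⊤ ⊤ (by simp) (by simp)]
    simp
  map_mul' I J := by
    rw [fracRelNormFun_eq F E (I * J) (I.num * J.num)
      (Ideal.span {(I.den : 𝓞 E)} * Ideal.span {(J.den : 𝓞 E)})]
    · simp only [fracRelNormFun, map_mul, FractionalIdeal.coeIdeal_mul]
      rw [div_mul_div_comm]
    · simp [Ideal.span_singleton_mul_span_singleton]
    · simp only [FractionalIdeal.coeIdeal_mul, ← mul_den_eq_num]
      ring

/-- The relative norm `N_{E/F} : 𝓘_E → 𝓘_F`. -/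
def idealNorm : IdealGroup E →* IdealGroup F := Units.map (fracRelNorm F E)

/-- The relative norm `N_{E/F} : E_E → E_F` on unit groups. -/
def unitNorm : (𝓞 E)ˣ →* (𝓞 F)ˣ := Units.map (RingOfIntegers.norm F)

/-- The unit norm index `(E_F : N_{E/F}(E_E))`. -/
def unitNormIndex : ℕ := (unitNorm F E).range.index

end Extension

/-- The action of an automorphism `g` of `k` on ideals, `𝔞 ↦ g(𝔞)`. -/
def galIdeal {k : Type*} [Field k] [NumberField k] (g : k ≃+* k) : IdealGroup k ≃* IdealGroup k :=
  Units.mapEquiv (FractionalIdeal.ringEquivOfRingEquiv k k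
    (NumberField.RingOfIntegers.mapRingEquiv g)).toMulEquiv

section Invariants

variable (k₀ L k : Type*) [Field k₀] [NumberField k₀] [Field L] [NumberField L]
  [Field k] [NumberField k] [Algebra k₀ k] [Algebra L k]

/-- `𝓘_k^G`: the ideals of `k` invariant under `G = Gal(k/k₀)`. -/
def ambiguousIdeals : Subgroup (IdealGroup k) where
  carrier := {I | ∀ g : k ≃ₐ[k₀] k, galIdeal g.toRingEquiv I = I}
  mul_mem' := fun ha hb g => by rw [map_mul, ha g, hb g]
  one_mem' := fun g => map_one _
  inv_mem' := fun ha g => by rw [map_inv, ha g]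

/-- `𝓟_k^G`: the ambiguous principal ideals of `k/k₀`. -/
def ambiguousPrincipalIdeals : Subgroup (IdealGroup k) :=
  principalIdeals k ⊓ ambiguousIdeals k₀ k

/-- `𝓟_L^G`: the principal ideals of `L` whose extension to `k` is invariant under
`G = Gal(k/k₀)`. -/
def absoluteAmbiguousPrincipalIdeals : Subgroup (IdealGroup L) :=
  principalIdeals L ⊓ (ambiguousIdeals k₀ k).comap (idealExt L k)

/-- `𝓟_L^G / 𝓟_ℚ`: the group of absolute principal factors. -/
abbrev AbsolutePrincipalFactors : Type _ :=
  absoluteAmbiguousPrincipalIdeals k₀ L k ⧸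
    (extendedPrincipalIdeals ℚ L).subgroupOf (absoluteAmbiguousPrincipalIdeals k₀ L k)

/-- The ambiguous principal ideals `𝔞` of `k/k₀` with trivial norm `N_{k/L}(𝔞)` in
`𝓘_L / 𝓘_ℚ`. -/
def relativeAmbiguousPrincipalIdeals : Subgroup (IdealGroup k) :=
  ambiguousPrincipalIdeals k₀ k ⊓
    ((QuotientGroup.mk' (extendedIdeals ℚ L)).comp (idealNorm L k)).ker

/-- `ker(N_{k/L}) ∩ (𝓟_k^G / 𝓟_{k₀})`: the group of relative principal factors. -/
abbrev RelativePrincipalFactors : Type _ :=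
  relativeAmbiguousPrincipalIdeals k₀ L k ⧸
    (extendedPrincipalIdeals k₀ k).subgroupOf (relativeAmbiguousPrincipalIdeals k₀ L k)

/-- The nonzero prime ideals of `k₀` which ramify in `k`. -/
def ramifiedPrimes : Set (IsDedekindDomain.HeightOneSpectrum (𝓞 k₀)) :=
  {v | ∃ P ∈ v.asIdeal.primesOver (𝓞 k), 1 < P.ramificationIdx (𝓞 k₀)}

/-- The primes of `k₀` lying over rational primes which split completely in `k₀/ℚ`. -/
def splitPrimes : Set (IsDedekindDomain.HeightOneSpectrum (𝓞 k₀)) :=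
  {v | ((v.asIdeal.under ℤ).primesOver (𝓞 k₀)).ncard = Module.finrank ℚ k₀}

end Invariants

/-- The three principal factorization types. -/
inductive PFType
  | alpha
  | beta
  | gamma

/-- The triple `(U, A, R)` that characterizes a principal factorization type. -/
def PFType.invariants : PFType → ℕ × ℕ × ℕ
  | .alpha => (1, 1, 1)
  | .beta => (1, 2, 0)
  | .gamma => (0, 1, 0)

end PureCubic

end

open scoped NumberField nonZeroDivisors

noncomputable section

namespace PureCubic

open IsDedekindDomain

/-! ### Principal ideals and automorphisms -/

section Principal

variable {F : Type*} [Field F] [NumberField F]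

/-! Let `σ` generate `G`. A principal ideal `(x)` is ambiguous exactly when `σ(x)/x` is a unit, and
Hilbert 90 says that the units so obtained are those of norm one. Hence `𝓟_k^G/𝓟_{k₀}` is `ker N /
E_k^{σ-1}` (`relIndex_ambiguousPrincipalIdeals`). Its order is found by comparing indices in `E_k`.
Modulo torsion, `E_k` has rank two and `1 + σ + σ² = 0` there, so `σ - 1` has index 3. Torsion
contributes the kernel `E_{k₀}`, and `ker N` has index `#N(E_k)`. The order is therefore `3·(E_{k₀}
: N E_k) = 3^(U+1)` (`relIndex_range_unitDiv_ker_unitNorm`).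

The norm to `L` splits this group. Modulo `𝓟_ℚ` its image is `𝓟_L^G/𝓟_ℚ`, because norm after
extension is squaring and that quotient is killed by 3; its kernel consists of the relative factors.
So `A + R = U + 1` (`relIndex_relative_mul_relIndex_absolute`). Every cube in `E_{k₀}`, a group of
at most six elements, is a norm, so `U ≤ 1`. The ideal generated by the cube root gives `A ≥ 1`.
Only three triples remain.

For the estimates, an ambiguous principal ideal `I` satisfies `I³ = N(I)`. Since `k₀` has class
number one, `I` is determined modulo `𝓟_{k₀}` by the orders of `N(I)` modulo 3 at the ramified
primes (`mem_extendedPrincipalIdeals_of_dvd`). The involution `τ` fixing `L` permutes these primes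
and moves exactly the split ones. The vector of orders is symmetric under `τ` for ideals from `L`
and antisymmetric for relative factors. This leaves `t - s` and `s` free coordinates
(`relIndex_absolute_le`, `relIndex_relative_le`). -/

theorem toPrincipalIdeal_eq_one_iff (x : Fˣ) :
    toPrincipalIdeal (𝓞 F) F x = 1 ↔ ∃ u : (𝓞 F)ˣ, ((u : 𝓞 F) : F) = x := by
  rw [toPrincipalIdeal_eq_iff, Units.val_one, ← FractionalIdeal.spanSingleton_one]
  constructor
  · intro h
    have h1 : (x : F) ∈ FractionalIdeal.spanSingleton (𝓞 F)⁰ (1 : F) := by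
      rw [← h]; exact FractionalIdeal.mem_spanSingleton_self _ _
    have h2 : (1 : F) ∈ FractionalIdeal.spanSingleton (𝓞 F)⁰ (x : F) := by
      rw [h]; exact FractionalIdeal.mem_spanSingleton_self _ _
    obtain ⟨a, ha⟩ := (FractionalIdeal.mem_spanSingleton _).1 h1
    obtain ⟨b, hb⟩ := (FractionalIdeal.mem_spanSingleton _).1 h2
    rw [Algebra.smul_def] at ha hb
    have hab : a * b = 1 := by
      apply NumberField.RingOfIntegers.ext
      change algebraMap (𝓞 F) F (a * b) = algebraMap (𝓞 F) F 1
      rw [map_mul, map_one, mul_comm, ← hb, ← ha, mul_one]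
    exact ⟨⟨a, b, hab, by rw [mul_comm, hab]⟩, by rw [← ha, mul_one]⟩
  · rintro ⟨u, hu⟩
    rw [← hu]
    apply le_antisymm
    · rw [FractionalIdeal.spanSingleton_le_iff_mem, FractionalIdeal.mem_spanSingleton]
      exact ⟨u, by rw [Algebra.smul_def, mul_one]⟩
    · rw [FractionalIdeal.spanSingleton_le_iff_mem, FractionalIdeal.mem_spanSingleton]
      exact ⟨(u⁻¹ : (𝓞 F)ˣ), by rw [Algebra.smul_def, ← map_mul, Units.inv_mul, map_one]⟩

theorem toPrincipalIdeal_surjective_of_isPrincipalIdealRing [IsPrincipalIdealRing (𝓞 F)] :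
    Function.Surjective (toPrincipalIdeal (𝓞 F) F) := by
  intro I
  have := mem_principal_ideals_iff (I := I)
  refine this.2 ?_
  obtain ⟨x, hx⟩ := (FractionalIdeal.isPrincipal_iff (I : FractionalIdeal (𝓞 F)⁰ F)).1 inferInstance
  exact ⟨x, hx.symm⟩

/-- An automorphism maps the ideal of `x` to the ideal of its image. -/
theorem galIdeal_toPrincipalIdeal (g : F ≃+* F) (x : Fˣ) :
    galIdeal g (toPrincipalIdeal (𝓞 F) F x) =
      toPrincipalIdeal (𝓞 F) F (Units.map (g : F →* F) x) := by
  apply Units.ext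
  rw [coe_toPrincipalIdeal]
  simp only [galIdeal, Units.coe_mapEquiv, Units.coe_map]
  rw [coe_toPrincipalIdeal]
  have hg : ∀ y : F, IsFractionRing.ringEquivOfRingEquiv (K := F) (L := F)
      (NumberField.RingOfIntegers.mapRingEquiv g) y = g y := by
    intro y
    obtain ⟨a, b, hb, rfl⟩ := IsFractionRing.div_surjective (A := 𝓞 F) y
    rw [map_div₀, map_div₀, IsFractionRing.ringEquivOfRingEquiv_algebraMap,
      IsFractionRing.ringEquivOfRingEquiv_algebraMap]
    rfl
  exact (FractionalIdeal.ringEquivOfRingEquiv_spanSingleton F F _ (x : F)).trans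
    (congrArg (FractionalIdeal.spanSingleton (𝓞 F)⁰) (hg x))

end Principal

/-! ### Extension and norm of principal ideals -/

section Extension

variable (F E : Type*) [Field F] [NumberField F] [Field E] [NumberField E] [Algebra F E]

theorem idealExt_toPrincipalIdeal (x : Fˣ) :
    idealExt F E (toPrincipalIdeal (𝓞 F) F x) =
      toPrincipalIdeal (𝓞 E) E (Units.map (algebraMap F E : F →* E) x) := by
  apply Units.ext
  rw [coe_toPrincipalIdeal]
  simp only [idealExt, Units.coe_map]
  rw [coe_toPrincipalIdeal]
  change FractionalIdeal.extendedHom (A := 𝓞 F) (K := F) E (𝓞 E)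
    (FractionalIdeal.spanSingleton (𝓞 F)⁰ (x : F)) = FractionalIdeal.spanSingleton (𝓞 E)⁰ _
  rw [FractionalIdeal.extendedHom_spanSingleton]
  congr 1
  obtain ⟨a, b, hb, hx⟩ := IsFractionRing.div_surjective (A := 𝓞 F) (x : F)
  rw [← hx, map_div₀, IsFractionRing.map, IsLocalization.map_eq, IsLocalization.map_eq]
  simp only [MonoidHom.coe_coe, map_div₀]
  rfl

theorem idealExt_injective : Function.Injective (idealExt F E) := by
  intro I J h
  apply Units.ext
  exact FractionalIdeal.extendedHom_injective (𝓞 F) F E (𝓞 E) (congrArg Units.val h)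

theorem idealNorm_toPrincipalIdeal (x : Eˣ) :
    idealNorm F E (toPrincipalIdeal (𝓞 E) E x) =
      toPrincipalIdeal (𝓞 F) F (Units.map (Algebra.norm F : E →* F) x) := by
  apply Units.ext
  rw [coe_toPrincipalIdeal]
  change fracRelNormFun F E _ = _
  obtain ⟨a, b, hb, hx⟩ := IsFractionRing.div_surjective (A := 𝓞 E) (x : E)
  have hb0 : b ≠ 0 := nonZeroDivisors.ne_zero hb
  have hbE : algebraMap (𝓞 E) E b ≠ 0 := by simpa using hb0
  have hx_norm : Algebra.norm F (x : E) =
      Algebra.norm F (algebraMap (𝓞 E) E a) / Algebra.norm F (algebraMap (𝓞 E) E b) := by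
    rw [eq_div_iff (Algebra.norm_ne_zero_iff.2 hbE), ← map_mul, ← hx, div_mul_cancel₀ _ hbE]
  rw [fracRelNormFun_eq F E _ (Ideal.span {a}) (Ideal.span {b}) (by simpa using hb0),
    Ideal.relNorm_singleton, Ideal.relNorm_singleton, FractionalIdeal.coeIdeal_span_singleton,
    FractionalIdeal.coeIdeal_span_singleton, Algebra.algebraMap_intNorm (L := E) (K := F),
    Algebra.algebraMap_intNorm (L := E) (K := F), FractionalIdeal.spanSingleton_div_spanSingleton,
    ← hx_norm]
  · rfl
  · rw [coe_toPrincipalIdeal, FractionalIdeal.coeIdeal_span_singleton,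
      FractionalIdeal.coeIdeal_span_singleton, FractionalIdeal.spanSingleton_mul_spanSingleton,
      ← hx, div_mul_cancel₀ _ hbE]

end Extension

/-! ### Orders of fractional ideals at primes -/

section Order

variable {F : Type*} [Field F] [NumberField F]

/-- The order of a nonzero fractional ideal at a prime. -/
def ord (v : HeightOneSpectrum (𝓞 F)) (I : IdealGroup F) : ℤ :=
  FractionalIdeal.count F v (I : FractionalIdeal (𝓞 F)⁰ F)

theorem ord_mul (v : HeightOneSpectrum (𝓞 F)) (I J : IdealGroup F) :
    ord v (I * J) = ord v I + ord v J := by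
  simp only [ord, Units.val_mul]
  exact FractionalIdeal.count_mul F v I.ne_zero J.ne_zero

theorem ord_pow (v : HeightOneSpectrum (𝓞 F)) (n : ℕ) (I : IdealGroup F) :
    ord v (I ^ n) = n * ord v I := by
  simp only [ord, Units.val_pow_eq_pow_val]
  exact FractionalIdeal.count_pow F v n I

theorem ord_one (v : HeightOneSpectrum (𝓞 F)) : ord v (1 : IdealGroup F) = 0 := by
  simpa using ord_pow v 0 1

theorem valuation_eq_exp_neg_ord (v : HeightOneSpectrum (𝓞 F)) (x : Fˣ) :
    v.valuation F x = WithZero.exp (-ord v (toPrincipalIdeal (𝓞 F) F x)) := by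
  obtain ⟨a, b, hb, hx⟩ := IsFractionRing.div_surjective (A := 𝓞 F) (x : F)
  have hb0 : b ≠ 0 := nonZeroDivisors.ne_zero hb
  have ha0 : a ≠ 0 := by
    rintro rfl
    exact x.ne_zero (by simpa using hx.symm)
  have hc := FractionalIdeal.count_well_defined F v
    (I := (toPrincipalIdeal (𝓞 F) F x : FractionalIdeal (𝓞 F)⁰ F)) (Units.ne_zero _)
    (a := b) (J := Ideal.span {a}) (by
      rw [coe_toPrincipalIdeal, FractionalIdeal.coeIdeal_span_singleton,
        FractionalIdeal.spanSingleton_mul_spanSingleton, ← hx, div_eq_inv_mul])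
  rw [ord, hc, ← hx, map_div₀, HeightOneSpectrum.valuation_of_algebraMap,
    HeightOneSpectrum.valuation_of_algebraMap, HeightOneSpectrum.intValuation_if_neg _ ha0,
    HeightOneSpectrum.intValuation_if_neg _ hb0, ← WithZero.exp_sub]
  congr 1
  ring

/-- A fractional ideal whose orders are all divisible by `n` is an `n`-th power. -/
theorem exists_pow_eq_of_dvd_ord {n : ℕ} (hn : n ≠ 0) (I : IdealGroup F)
    (h : ∀ v, (n : ℤ) ∣ ord v I) : ∃ J : IdealGroup F, J ^ n = I := by
  choose m hm using h
  have hI : (I : FractionalIdeal (𝓞 F)⁰ F) ≠ 0 := I.ne_zero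
  have hfin : (Function.mulSupport fun v : HeightOneSpectrum (𝓞 F) =>
      (v.asIdeal : FractionalIdeal (𝓞 F)⁰ F) ^ m v).Finite := by
    refine (Filter.eventually_cofinite.1
      (FractionalIdeal.finite_factors (I : FractionalIdeal (𝓞 F)⁰ F))).subset ?_
    intro v hv h0
    refine hv ?_
    have : m v = 0 := by
      have := (hm v).symm.trans h0
      simpa [hn] using this
    simp [this]
  have key : (∏ᶠ v : HeightOneSpectrum (𝓞 F),
      (v.asIdeal : FractionalIdeal (𝓞 F)⁰ F) ^ m v) ^ n = I := by
    rw [finprod_pow hfin, ← FractionalIdeal.finprod_heightOneSpectrum_factorization' F hI]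
    refine finprod_congr fun v => ?_
    rw [← zpow_natCast, ← zpow_mul, mul_comm]
    exact congrArg _ (hm v).symm
  refine ⟨Units.mk0 _ (fun h0 => hI ?_), Units.ext key⟩
  rw [← key, h0, zero_pow hn]

theorem ord_equiv (g : F ≃+* F) (v : HeightOneSpectrum (𝓞 F)) (x : Fˣ) :
    ord (HeightOneSpectrum.equivOfRingEquiv (NumberField.RingOfIntegers.mapRingEquiv g) v)
      (toPrincipalIdeal (𝓞 F) F (Units.map (g : F →* F) x)) =
    ord v (toPrincipalIdeal (𝓞 F) F x) := by
  set e := NumberField.RingOfIntegers.mapRingEquiv g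
  set w := HeightOneSpectrum.equivOfRingEquiv e v
  have hw : w.asIdeal = Ideal.map e v.asIdeal := (Ideal.map_comap_of_equiv e).symm
  let φ : Ideal (𝓞 F) ≃* Ideal (𝓞 F) :=
    { toFun := Ideal.map e
      invFun := Ideal.map e.symm
      left_inv := fun I => Ideal.map_of_equiv e
      right_inv := fun I => Ideal.map_of_equiv e.symm
      map_mul' := fun I J => Ideal.map_mul e I J }
  -- The integral valuation is a multiplicity in the monoid of ideals, so the monoid isomorphism `φ`
  -- preserves it.
  have hint (a : 𝓞 F) (ha : a ≠ 0) : w.intValuation (e a) = v.intValuation a := by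
    rw [HeightOneSpectrum.intValuation_eq_exp_neg_multiplicity w (by simpa using ha),
      HeightOneSpectrum.intValuation_eq_exp_neg_multiplicity v ha, hw, ← Set.image_singleton,
      ← Ideal.map_span e, show Ideal.map e v.asIdeal = φ v.asIdeal from rfl,
      show Ideal.map e (Ideal.span {a}) = φ (Ideal.span {a}) from rfl, multiplicity_map_eq φ]
  have hval (y : F) (hy : y ≠ 0) : w.valuation F (g y) = v.valuation F y := by
    obtain ⟨a, b, hb, rfl⟩ := IsFractionRing.div_surjective (A := 𝓞 F) y
    have hb0 : b ≠ 0 := nonZeroDivisors.ne_zero hb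
    have ha0 : a ≠ 0 := by
      rintro rfl
      simp at hy
    have he (c : 𝓞 F) : g (algebraMap (𝓞 F) F c) = algebraMap (𝓞 F) F (e c) := rfl
    rw [map_div₀, map_div₀, map_div₀, he, he, HeightOneSpectrum.valuation_of_algebraMap,
      HeightOneSpectrum.valuation_of_algebraMap, HeightOneSpectrum.valuation_of_algebraMap,
      HeightOneSpectrum.valuation_of_algebraMap, hint a ha0, hint b hb0]
  have h := hval x x.ne_zero
  rw [valuation_eq_exp_neg_ord v x] at h
  have h2 := valuation_eq_exp_neg_ord w (Units.map (g : F →* F) x)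
  rw [Units.coe_map, MonoidHom.coe_coe, h, WithZero.exp_inj] at h2
  linarith

end Order

/-! ### Orders under extension; finiteness of ramification -/

section Extension

variable (F E : Type*) [Field F] [NumberField F] [Field E] [NumberField E] [Algebra F E]

theorem ord_idealExt (v : HeightOneSpectrum (𝓞 F)) (w : HeightOneSpectrum (𝓞 E))
    [w.asIdeal.LiesOver v.asIdeal] (x : Fˣ) :
    ord w (idealExt F E (toPrincipalIdeal (𝓞 F) F x)) =
      w.asIdeal.ramificationIdx (𝓞 F) * ord v (toPrincipalIdeal (𝓞 F) F x) := by
  rw [idealExt_toPrincipalIdeal]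
  have h1 := HeightOneSpectrum.valuation_liesOver E v w (x : F)
  have h2 := valuation_eq_exp_neg_ord w (Units.map (algebraMap F E : F →* E) x)
  rw [valuation_eq_exp_neg_ord v x] at h1
  rw [Units.coe_map, MonoidHom.coe_coe, ← h1, ← WithZero.exp_nsmul, WithZero.exp_inj,
    Ideal.ramificationIdx'_eq_ramificationIdx _ _ v.ne_bot, nsmul_eq_mul] at h2
  linarith

/-- Any prime above `v` has ramification index one, so the order of `x` is the same there as at `v`,
and upstairs the ideal is an `n`-th power. -/
theorem dvd_ord_of_notMem_ramifiedPrimes (v : HeightOneSpectrum (𝓞 F))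
    (hv : v ∉ ramifiedPrimes F E) (n : ℕ) (x : Fˣ) (I : IdealGroup E)
    (h : idealExt F E (toPrincipalIdeal (𝓞 F) F x) = I ^ n) :
    (n : ℤ) ∣ ord v (toPrincipalIdeal (𝓞 F) F x) := by
  obtain ⟨⟨P, hP, hPv⟩⟩ := v.asIdeal.nonempty_primesOver (S := 𝓞 E)
  have hP0 : P ≠ ⊥ := Ideal.ne_bot_of_liesOver_of_ne_bot v.ne_bot P
  let w : HeightOneSpectrum (𝓞 E) := ⟨P, hP, hP0⟩
  have hw : w.asIdeal.LiesOver v.asIdeal := hPv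
  have hpos : 0 < P.ramificationIdx (𝓞 F) := Ideal.ramificationIdx_pos P (𝓞 F)
  have hle : ¬ 1 < P.ramificationIdx (𝓞 F) := fun h1 => hv ⟨P, ⟨hP, hPv⟩, h1⟩
  have h1 := ord_idealExt F E v w x
  rw [h, ord_pow, show w.asIdeal.ramificationIdx (𝓞 F) = 1 by
    change P.ramificationIdx (𝓞 F) = 1; omega] at h1
  exact ⟨ord w I, by rw [h1]; simp⟩

/-- Ramified primes lie below divisors of the different, which is a nonzero ideal. -/
theorem ramifiedPrimes_finite : (ramifiedPrimes F E).Finite := by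
  have hD : differentIdeal (𝓞 F) (𝓞 E) ≠ ⊥ := differentIdeal_ne_bot
  have hfin : {P : Ideal (𝓞 E) | P ∣ differentIdeal (𝓞 F) (𝓞 E)}.Finite := by
    have : Fintype (Ideal (𝓞 E))ˣ := Fintype.ofFinite _
    have : Fintype {P // P ∣ differentIdeal (𝓞 F) (𝓞 E)} :=
      UniqueFactorizationMonoid.fintypeSubtypeDvd _ hD
    exact Set.finite_coe_iff.1 (Finite.of_fintype {P // P ∣ differentIdeal (𝓞 F) (𝓞 E)})
  refine Set.Finite.of_finite_image (f := HeightOneSpectrum.asIdeal)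
    ((hfin.image (Ideal.under (𝓞 F))).subset ?_) (fun v _ w _ h => HeightOneSpectrum.ext h)
  rintro _ ⟨v, ⟨P, ⟨hP, hPv⟩, hram⟩, rfl⟩
  refine ⟨P, dvd_differentIdeal_iff.2 fun hun => ?_, (hPv.over).symm⟩
  rw [Ideal.ramificationIdx_eq_one P (𝓞 F)] at hram
  exact lt_irrefl _ hram

end Extension

/-! ### Index of `s - 1` on a finitely generated abelian group -/

section Index

/-- An automorphism `s` of a free abelian group of rank two with `1 + s + s ^ 2 = 0`: the index of
the image of `s - 1` is three. -/
theorem index_range_sub_id_eq_three {M : Type*} [AddCommGroup M] [Module.Free ℤ M]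
    [Module.Finite ℤ M] (hM : Module.finrank ℤ M = 2) (s : M ≃+ M)
    (hs : ∀ x, x + s x + s (s x) = 0) (f : M →+ M) (hf : ∀ x, f x = s x - x) :
    Function.Injective f ∧ f.range.index = 3 := by
  -- Since `s² = -1 - s`, one has `(s - 1)² = s² - 2s + 1 = -3s`.
  have hff : ∀ x, f (f x) = (-3 : ℤ) • s x := by
    intro x
    have h := hs x
    rw [hf, hf, map_sub]
    have : s (s x) = -(x + s x) := by rw [eq_neg_iff_add_eq_zero, add_comm]; exact h
    rw [this]
    module
  have hinj : Function.Injective f := by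
    rw [injective_iff_map_eq_zero]
    intro x hx
    have h := hff x
    rw [hx, map_zero] at h
    have h' := (smul_eq_zero.1 h.symm).resolve_left (by norm_num)
    simpa using h'
  refine ⟨hinj, ?_⟩
  set fl : M →ₗ[ℤ] M := f.toIntLinearMap with hfl
  set sl : M ≃ₗ[ℤ] M := s.toIntLinearEquiv with hsl
  have hcomp : fl * fl = (-3 : ℤ) • (sl : M →ₗ[ℤ] M) := by
    ext x
    exact hff x
  -- In rank two the scalar `-3` contributes `9`; as `det s = ±1`, this forces `|det f| = 3`, which
  -- is the index of the image.
  have hdet : LinearMap.det fl * LinearMap.det fl = 9 * LinearMap.det (sl : M →ₗ[ℤ] M) := by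
    rw [← map_mul, hcomp, LinearMap.det_smul, hM]
    norm_num
  have hsdet : (LinearMap.det (sl : M →ₗ[ℤ] M)).natAbs = 1 :=
    Int.natAbs_of_isUnit (LinearEquiv.isUnit_det' sl)
  have hnat : (LinearMap.det fl).natAbs = 3 := by
    have := congrArg Int.natAbs hdet
    rw [Int.natAbs_mul, Int.natAbs_mul, hsdet] at this
    norm_num at this
    exact Nat.mul_self_inj.1 this
  have hcard := Submodule.natAbs_det_equiv (LinearMap.range fl)
    (LinearEquiv.ofInjective fl hinj)
  have hincl : (LinearMap.range fl).subtype ∘ₗ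
      AddMonoidHom.toIntLinearMap (LinearEquiv.ofInjective fl hinj : M →+ LinearMap.range fl) =
      fl := by
    ext x
    rfl
  rw [hincl, hnat] at hcard
  exact hcard.symm

/-- Comparison of the index of the image of an endomorphism with the one induced on a quotient by
a finite subgroup on which the induced endomorphism is injective. -/
theorem index_range_eq_card_ker_mul {A M : Type*} [AddCommGroup A] [AddCommGroup M]
    (π : A →+ M) (hπ : Function.Surjective π) [Finite π.ker] (f : A →+ A) (f' : M →+ M)
    (hff' : ∀ x, π (f x) = f' (π x)) (hinj : Function.Injective f') :
    f.range.index = Nat.card f.ker * f'.range.index := by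
  have hker : ∀ x, f x ∈ π.ker ↔ x ∈ π.ker := by
    intro x
    rw [AddMonoidHom.mem_ker, hff', AddMonoidHom.mem_ker, map_eq_zero_iff f' hinj]
  have h1 : f.range.map π = f'.range := by
    ext y
    constructor
    · rintro ⟨_, ⟨x, rfl⟩, rfl⟩
      exact ⟨π x, (hff' x).symm⟩
    · rintro ⟨m, rfl⟩
      obtain ⟨x, rfl⟩ := hπ m
      exact ⟨f x, ⟨x, rfl⟩, hff' x⟩
  have h2 : f'.range.index = (f.range ⊔ π.ker).index := by
    rw [← h1, AddSubgroup.index_map, AddMonoidHom.range_eq_top.2 hπ, AddSubgroup.index_top, mul_one]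
  let g : π.ker →+ π.ker := (f.comp π.ker.subtype).codRestrict π.ker fun x => (hker x).2 x.2
  have h3 : f.range.addSubgroupOf π.ker = g.range := by
    ext ⟨y, hy⟩
    constructor
    · rintro ⟨x, hx⟩
      exact ⟨⟨x, (hker x).1 (by rw [hx]; exact hy)⟩, Subtype.ext hx⟩
    · rintro ⟨x, hx⟩
      exact ⟨x, congrArg Subtype.val hx⟩
  -- On the finite group `π.ker` the index of the image equals the order of the kernel, and
  -- injectivity of `f'` puts all of `f.ker` inside `π.ker`.
  have h4 : f.range.relIndex π.ker = Nat.card f.ker := by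
    have hg : g.range.index = Nat.card g.ker := AddSubgroup.index_range
    rw [AddSubgroup.relIndex, h3, hg]
    refine Nat.card_congr ⟨fun x => ⟨x.1.1, congrArg Subtype.val x.2⟩,
      fun x => ⟨⟨x.1, (hker _).1 ?_⟩, Subtype.ext x.2⟩, fun x => rfl, fun x => rfl⟩
    rw [(x.2 : f x.1 = 0)]
    exact zero_mem _
  rw [h2, ← h4, ← AddSubgroup.relIndex_sup_left, AddSubgroup.relIndex_mul_index le_sup_left]

theorem index_range_div_id {A M : Type*} [CommGroup A] [CommGroup M]
    [Module.Free ℤ (Additive M)] [Module.Finite ℤ (Additive M)]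
    (hM : Module.finrank ℤ (Additive M) = 2) (π : A →* M) (hπ : Function.Surjective π)
    [Finite π.ker] (s : A ≃* A) (s' : M ≃* M) (hss' : ∀ x, π (s x) = s' (π x))
    (hs' : ∀ x, x * s' x * s' (s' x) = 1) (f : A →* A) (hf : ∀ x, f x = s x / x) :
    f.range.index = 3 * Nat.card f.ker := by
  let f' : M →* M :=
    { toFun := fun x => s' x / x
      map_one' := by simp
      map_mul' := fun x y => by rw [map_mul, mul_div_mul_comm] }
  obtain ⟨hinj, h3⟩ := index_range_sub_id_eq_three hM (MulEquiv.toAdditive s') hs'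
    (MonoidHom.toAdditive f') fun x => rfl
  have : Finite (MonoidHom.toAdditive π).ker := inferInstanceAs (Finite π.ker)
  have key := index_range_eq_card_ker_mul (MonoidHom.toAdditive π) hπ (MonoidHom.toAdditive f)
    (MonoidHom.toAdditive f') (fun x => ?_) hinj
  · rw [h3, mul_comm] at key
    exact key
  · change π (f (Additive.toMul x)) = s' (π (Additive.toMul x)) / π (Additive.toMul x)
    rw [hf, map_div, hss']

end Index

/-! ### The unit group as a Galois module -/

section Units

set_option linter.unusedSectionVars false

variable {k₀ k : Type*} [Field k₀] [NumberField k₀] [Field k] [NumberField k] [Algebra k₀ k]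

/-- The action of an automorphism on the unit group. -/
def unitAut (g : k ≃ₐ[k₀] k) : (𝓞 k)ˣ ≃* (𝓞 k)ˣ :=
  Units.mapEquiv (NumberField.RingOfIntegers.mapRingEquiv g.toRingEquiv).toMulEquiv

theorem coe_unitAut (g : k ≃ₐ[k₀] k) (u : (𝓞 k)ˣ) :
    ((unitAut g u : 𝓞 k) : k) = g ((u : 𝓞 k) : k) := rfl

/-- The endomorphism `u ↦ g(u) / u` of the unit group. -/
def unitDiv (g : k ≃ₐ[k₀] k) : (𝓞 k)ˣ →* (𝓞 k)ˣ where
  toFun u := unitAut g u / u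
  map_one' := by simp
  map_mul' u v := by rw [map_mul, mul_div_mul_comm]

theorem norm_eq_mul_of_orderOf_eq_three [IsGalois k₀ k] (σ : k ≃ₐ[k₀] k)
    (hσ : ∀ g, g ∈ Subgroup.zpowers σ) (h3 : orderOf σ = 3) (x : k) :
    algebraMap k₀ k (Algebra.norm k₀ x) = x * σ x * σ (σ x) := by
  classical
  rw [Algebra.norm_eq_prod_automorphisms, ← IsCyclic.image_range_orderOf hσ, h3,
    Finset.prod_image]
  · simp [Finset.prod_range_succ]
  · intro i hi j hj hij
    have hi' : i < orderOf σ := by rw [h3]; simpa using hi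
    have hj' : j < orderOf σ := by rw [h3]; simpa using hj
    exact pow_injOn_Iio_orderOf hi' hj' hij

theorem units_ext {u v : (𝓞 k)ˣ} (h : ((u : 𝓞 k) : k) = ((v : 𝓞 k) : k)) : u = v :=
  Units.ext (NumberField.RingOfIntegers.ext h)

variable (k₀ k) in
/-- The inclusion of unit groups. -/
def unitMap : (𝓞 k₀)ˣ →* (𝓞 k)ˣ := Units.map (algebraMap (𝓞 k₀) (𝓞 k) : 𝓞 k₀ →* 𝓞 k)

theorem coe_unitMap (u : (𝓞 k₀)ˣ) :
    ((unitMap k₀ k u : 𝓞 k) : k) = algebraMap k₀ k ((u : 𝓞 k₀) : k₀) := rfl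

theorem unitMap_injective : Function.Injective (unitMap k₀ k) := by
  intro u v h
  refine units_ext ((algebraMap k₀ k).injective ?_)
  rw [← coe_unitMap, ← coe_unitMap, h]

theorem coe_unitNorm (u : (𝓞 k)ˣ) :
    ((unitNorm k₀ k u : 𝓞 k₀) : k₀) = Algebra.norm k₀ ((u : 𝓞 k) : k) := rfl

variable [IsGalois k₀ k] (σ : k ≃ₐ[k₀] k)

theorem mem_range_algebraMap_of_fixed (hσ : ∀ g, g ∈ Subgroup.zpowers σ) (x : k) (hx : σ x = x) :
    ∃ y, algebraMap k₀ k y = x := by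
  rw [← Set.mem_range, ← Algebra.coe_bot (R := k₀) (A := k)]
  have : x ∈ (⊥ : IntermediateField k₀ k) := by
    rw [IsGalois.mem_bot_iff_fixed]
    intro g
    obtain ⟨n, rfl⟩ := hσ g
    have h : σ ∈ MulAction.stabilizer (k ≃ₐ[k₀] k) x := hx
    exact Subgroup.zpow_mem _ h n
  exact this

theorem unitDiv_ker (hσ : ∀ g, g ∈ Subgroup.zpowers σ) : (unitDiv σ).ker = (unitMap k₀ k).range := by
  ext u
  rw [MonoidHom.mem_ker]
  change unitAut σ u / u = 1 ↔ _
  rw [div_eq_one]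
  constructor
  · intro h
    have hu : ∀ w : (𝓞 k)ˣ, unitAut σ w = w → ∃ a : 𝓞 k₀, algebraMap (𝓞 k₀) (𝓞 k) a = w := by
      intro w hw
      obtain ⟨y, hy⟩ := mem_range_algebraMap_of_fixed σ hσ ((w : 𝓞 k) : k)
        (by rw [← coe_unitAut, hw])
      have hint : IsIntegral ℤ y := by
        have := (w : 𝓞 k).2
        rw [← isIntegral_algebraMap_iff (algebraMap k₀ k).injective (B := k), hy]
        exact this
      exact ⟨⟨y, hint⟩, NumberField.RingOfIntegers.ext hy⟩
    obtain ⟨a, ha⟩ := hu u h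
    obtain ⟨b, hb⟩ := hu u⁻¹ (by rw [map_inv, h])
    have hab : a * b = 1 := by
      apply FaithfulSMul.algebraMap_injective (𝓞 k₀) (𝓞 k)
      rw [map_mul, ha, hb, map_one, Units.mul_inv]
    exact ⟨⟨a, b, hab, by rw [mul_comm, hab]⟩, Units.ext ha⟩
  · rintro ⟨v, rfl⟩
    apply units_ext
    rw [coe_unitAut, coe_unitMap, AlgEquiv.commutes]

/-- The product `u·σ(u)·σ²(u)` is a norm from the finite group `E_{k₀}`, hence torsion. So `1 + σ +
σ² = 0` holds on units modulo torsion, and the general index computation applies, with the kernel of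
`σ - 1` equal to `E_{k₀}`. -/
theorem index_range_unitDiv (hσ : ∀ g, g ∈ Subgroup.zpowers σ)
    (h3 : orderOf σ = 3) [Finite (𝓞 k₀)ˣ]
    (hr : NumberField.Units.rank k = 2) :
    (unitDiv σ).range.index = 3 * Nat.card (𝓞 k₀)ˣ := by
  let T := NumberField.Units.torsion k
  have hT : T.map (unitAut σ : (𝓞 k)ˣ →* (𝓞 k)ˣ) = T := by
    ext u
    constructor
    · rintro ⟨w, hw, rfl⟩
      exact (CommGroup.mem_torsion _).2
        (MonoidHom.isOfFinOrder _ ((CommGroup.mem_torsion _).1 hw))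
    · intro hu
      refine ⟨(unitAut σ).symm u, (CommGroup.mem_torsion _).2 ?_, (unitAut σ).apply_symm_apply u⟩
      exact MonoidHom.isOfFinOrder ((unitAut σ).symm : (𝓞 k)ˣ →* (𝓞 k)ˣ)
        ((CommGroup.mem_torsion _).1 hu)
  let s : (𝓞 k)ˣ ⧸ T ≃* (𝓞 k)ˣ ⧸ T := QuotientGroup.congr T T (unitAut σ) hT
  have hs : ∀ x : (𝓞 k)ˣ ⧸ T, x * s x * s (s x) = 1 := by
    intro x
    obtain ⟨u, rfl⟩ := QuotientGroup.mk_surjective x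
    change ((u * unitAut σ u * unitAut σ (unitAut σ u) : (𝓞 k)ˣ) : (𝓞 k)ˣ ⧸ T) = 1
    rw [QuotientGroup.eq_one_iff]
    have : u * unitAut σ u * unitAut σ (unitAut σ u) = unitMap k₀ k (unitNorm k₀ k u) := by
      apply units_ext
      rw [coe_unitMap, coe_unitNorm, norm_eq_mul_of_orderOf_eq_three σ hσ h3]
      rfl
    rw [this]
    exact (CommGroup.mem_torsion _).2
      (MonoidHom.isOfFinOrder _ (isOfFinOrder_of_finite _))
  have hfin : Finite (QuotientGroup.mk' T).ker := by
    rw [QuotientGroup.ker_mk']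
    exact inferInstanceAs (Finite (NumberField.Units.torsion k))
  rw [index_range_div_id (NumberField.Units.finrank_modTorsion k |>.trans hr)
    (QuotientGroup.mk' T) (QuotientGroup.mk'_surjective T) (unitAut σ) s (fun x => rfl) hs
    (unitDiv σ) (fun x => rfl), unitDiv_ker σ hσ,
    Nat.card_congr (MonoidHom.ofInjective (unitMap_injective (k₀ := k₀) (k := k))).toEquiv]

/-- Divide the index `3·#E_{k₀}` of `E_k^{σ-1}` by the index `#N(E_k)` of the norm kernel; the
quotient is three times the unit norm index. -/
theorem relIndex_range_unitDiv_ker_unitNorm (hσ : ∀ g, g ∈ Subgroup.zpowers σ)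
    (h3 : orderOf σ = 3) [Finite (𝓞 k₀)ˣ]
    (hr : NumberField.Units.rank k = 2) :
    (unitDiv σ).range.relIndex (unitNorm k₀ k).ker = 3 * unitNormIndex k₀ k := by
  have hle : (unitDiv σ).range ≤ (unitNorm k₀ k).ker := by
    rintro _ ⟨u, rfl⟩
    rw [MonoidHom.mem_ker]
    change unitNorm k₀ k (unitAut σ u / u) = 1
    rw [map_div, div_eq_one]
    apply units_ext
    rw [coe_unitNorm, coe_unitNorm, coe_unitAut]
    exact Algebra.norm_eq_of_algEquiv σ _
  have h1 := Subgroup.relIndex_mul_index hle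
  rw [index_range_unitDiv σ hσ h3 hr, Subgroup.index_ker] at h1
  have h2 := Subgroup.card_mul_index (unitNorm k₀ k).range
  have hpos : 0 < Nat.card (unitNorm k₀ k).range := Nat.card_pos
  rw [unitNormIndex]
  apply Nat.eq_of_mul_eq_mul_right hpos
  rw [h1, ← h2]
  ring

end Units

/-! ### Ambiguous principal ideals and Hilbert 90 -/

section AmbiguousPrincipal

set_option linter.unusedSectionVars false

variable {k₀ k : Type*} [Field k₀] [NumberField k₀] [Field k] [NumberField k] [Algebra k₀ k]

theorem toPrincipalIdeal_mem_ambiguousPrincipalIdeals_iff (x : kˣ) :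
    toPrincipalIdeal (𝓞 k) k x ∈ ambiguousPrincipalIdeals k₀ k ↔
      ∀ g : k ≃ₐ[k₀] k, toPrincipalIdeal (𝓞 k) k (Units.map (g : k →* k) x) =
        toPrincipalIdeal (𝓞 k) k x := by
  have h : toPrincipalIdeal (𝓞 k) k x ∈ ambiguousPrincipalIdeals k₀ k ↔
      ∀ g : k ≃ₐ[k₀] k, galIdeal g.toRingEquiv (toPrincipalIdeal (𝓞 k) k x) =
        toPrincipalIdeal (𝓞 k) k x :=
    ⟨fun h => h.2, fun h => ⟨⟨x, rfl⟩, h⟩⟩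
  rw [h]
  refine forall_congr' fun g => ?_
  rw [galIdeal_toPrincipalIdeal]
  rfl

/-- The endomorphism `x ↦ g(x) / x` of the multiplicative group. -/
def fieldDiv (g : k ≃ₐ[k₀] k) : kˣ →* kˣ where
  toFun x := Units.map (g : k →* k) x / x
  map_one' := by simp
  map_mul' u v := by rw [map_mul, mul_div_mul_comm]

variable (k) in
/-- Units as elements of the field. -/
def unitIncl : (𝓞 k)ˣ →* kˣ := Units.map (algebraMap (𝓞 k) k : 𝓞 k →* k)

theorem unitIncl_injective : Function.Injective (unitIncl k) := by
  intro u v h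
  exact units_ext (congrArg Units.val h)

theorem ker_toPrincipalIdeal : (toPrincipalIdeal (𝓞 k) k).ker = (unitIncl k).range := by
  ext x
  rw [MonoidHom.mem_ker, toPrincipalIdeal_eq_one_iff]
  exact ⟨fun ⟨u, hu⟩ => ⟨u, Units.ext hu⟩, fun ⟨u, hu⟩ => ⟨u, congrArg Units.val hu⟩⟩

variable [IsGalois k₀ k] (σ : k ≃ₐ[k₀] k)

theorem ker_fieldDiv (hσ : ∀ g, g ∈ Subgroup.zpowers σ) :
    (fieldDiv σ).ker = (Units.map (algebraMap k₀ k : k₀ →* k)).range := by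
  ext x
  rw [MonoidHom.mem_ker]
  change Units.map (σ : k →* k) x / x = 1 ↔ _
  rw [div_eq_one]
  constructor
  · intro h
    obtain ⟨y, hy⟩ := mem_range_algebraMap_of_fixed σ hσ (x : k) (congrArg Units.val h)
    refine ⟨Units.mk0 y ?_, Units.ext hy⟩
    rintro rfl
    exact x.ne_zero (by rw [← hy, map_zero])
  · rintro ⟨y, rfl⟩
    exact Units.ext (σ.commutes y)

theorem mem_ambiguousPrincipalIdeals_iff_generator (hσ : ∀ g, g ∈ Subgroup.zpowers σ) (x : kˣ) :
    toPrincipalIdeal (𝓞 k) k x ∈ ambiguousPrincipalIdeals k₀ k ↔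
      fieldDiv σ x ∈ (unitIncl k).range := by
  rw [toPrincipalIdeal_mem_ambiguousPrincipalIdeals_iff, ← ker_toPrincipalIdeal, MonoidHom.mem_ker]
  change _ ↔ toPrincipalIdeal (𝓞 k) k (Units.map (σ : k →* k) x / x) = 1
  rw [map_div, div_eq_one]
  refine ⟨fun h => h σ, fun h g => ?_⟩
  -- The stabilizer of the ideal is a subgroup, so invariance under the generator suffices.
  let S : Subgroup (k ≃ₐ[k₀] k) :=
    { carrier := {g | galIdeal g.toRingEquiv (toPrincipalIdeal (𝓞 k) k x) =
        toPrincipalIdeal (𝓞 k) k x}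
      one_mem' := by
        change galIdeal _ _ = _
        rw [galIdeal_toPrincipalIdeal]
        rfl
      mul_mem' := by
        intro a b ha hb
        change galIdeal _ _ = _ at ha hb ⊢
        rw [galIdeal_toPrincipalIdeal] at hb ⊢
        have : Units.map ((a * b).toRingEquiv : k →* k) x =
            Units.map (a.toRingEquiv : k →* k) (Units.map (b.toRingEquiv : k →* k) x) := rfl
        rw [this, ← galIdeal_toPrincipalIdeal, hb, ha]
      inv_mem' := by
        intro a ha
        change galIdeal _ _ = _ at ha ⊢
        have : galIdeal a⁻¹.toRingEquiv (galIdeal a.toRingEquiv (toPrincipalIdeal (𝓞 k) k x)) =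
            toPrincipalIdeal (𝓞 k) k x := by
          rw [galIdeal_toPrincipalIdeal, galIdeal_toPrincipalIdeal]
          congr 1
          exact Units.ext (a.symm_apply_apply x)
        rwa [ha] at this }
  have hS : σ ∈ S := by
    change galIdeal _ _ = _
    rw [galIdeal_toPrincipalIdeal]
    exact h
  have hg : g ∈ S := (Subgroup.zpowers_le.2 hS) (hσ g)
  change galIdeal _ _ = _ at hg
  rw [galIdeal_toPrincipalIdeal] at hg
  exact hg

/-- Hilbert's Theorem 90 for an automorphism of order three. -/
theorem exists_mul_eq_of_mul_eq_one (h3 : orderOf σ = 3) (u : k) (hu : u * σ u * σ (σ u) = 1) :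
    ∃ y : kˣ, u * σ y = y := by
  have hind : LinearIndependent k (fun i : Fin 3 => ((σ ^ (i : ℕ) : k ≃ₐ[k₀] k) : k → k)) := by
    refine LinearIndependent.comp (linearIndependent_monoidHom k k)
      (fun i : Fin 3 => ((σ ^ (i : ℕ) : k ≃ₐ[k₀] k) : k →* k)) fun i j hij => ?_
    have h : σ ^ (i : ℕ) = σ ^ (j : ℕ) := AlgEquiv.ext fun x => DFunLike.congr_fun hij x
    exact Fin.ext (pow_injOn_Iio_orderOf (by rw [h3]; exact i.2) (by rw [h3]; exact j.2) h)
  -- The Lagrange resolvent is not identically zero, by independence of the characters `1, σ, σ²`.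
  -- Applying `σ` and multiplying by `u` permutes its terms cyclically because `u` has norm one.
  obtain ⟨c, hc⟩ : ∃ c : k, c + u * σ c + u * σ u * σ (σ c) ≠ 0 := by
    by_contra! hzero
    have := Fintype.linearIndependent_iff.1 hind ![1, u, u * σ u] (by
      ext c
      have := hzero c
      simpa [Fin.sum_univ_three, pow_two] using this) 0
    simp at this
  refine ⟨Units.mk0 _ hc, ?_⟩
  have hσ3 : σ (σ (σ c)) = c := by
    have h : σ ^ 3 = 1 := by rw [← h3]; exact pow_orderOf_eq_one σ
    have := DFunLike.congr_fun h c
    simpa [pow_succ] using this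
  simp only [Units.val_mk0, map_add, map_mul, hσ3]
  linear_combination c * hu

/-- The group of ambiguous principal ideals modulo ideals from the base field is the first
cohomology group of the units. -/
theorem relIndex_ambiguousPrincipalIdeals (hσ : ∀ g, g ∈ Subgroup.zpowers σ)
    (h3 : orderOf σ = 3) :
    (extendedPrincipalIdeals k₀ k).relIndex (ambiguousPrincipalIdeals k₀ k) =
      (unitDiv σ).range.relIndex (unitNorm k₀ k).ker := by
  set D := fieldDiv σ with hD
  -- `W` is the group of generators of ambiguous principal ideals. Both quotients are `W` modulo
  -- `E_k·k₀ˣ`: the map to ideals kills `E_k`, the map `D` kills `k₀ˣ`.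
  set W : Subgroup kˣ := (unitIncl k).range.comap D with hW
  have hDι : (unitDiv σ).range.map (unitIncl k) = (unitIncl k).range.map D := by
    rw [MonoidHom.map_range, MonoidHom.map_range]
    congr 1
  have hEW : (unitIncl k).range ≤ W := by
    rintro _ ⟨u, rfl⟩
    exact ⟨unitDiv σ u, Units.ext rfl⟩
  have hkW : D.ker ≤ W := fun x hx => by
    rw [hW, Subgroup.mem_comap, MonoidHom.mem_ker.1 hx]
    exact one_mem _
  have hWρ : W.map (toPrincipalIdeal (𝓞 k) k) = ambiguousPrincipalIdeals k₀ k := by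
    ext I
    constructor
    · rintro ⟨x, hx, rfl⟩
      exact (mem_ambiguousPrincipalIdeals_iff_generator σ hσ x).2 hx
    · intro hI
      obtain ⟨x, rfl⟩ := hI.1
      exact ⟨x, (mem_ambiguousPrincipalIdeals_iff_generator σ hσ x).1 hI, rfl⟩
  have hWD : W.map D = (unitNorm k₀ k).ker.map (unitIncl k) := by
    ext y
    constructor
    · rintro ⟨x, ⟨u, hu⟩, rfl⟩
      refine ⟨u, ?_, hu⟩
      rw [SetLike.mem_coe, MonoidHom.mem_ker]
      apply units_ext
      rw [coe_unitNorm]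
      have h1 : ((u : 𝓞 k) : k) = σ x / x := by
        have := congrArg Units.val hu
        simpa [hD, fieldDiv, unitIncl] using this
      have h2 : Algebra.norm k₀ (σ (x : k) / x) * Algebra.norm k₀ (x : k) =
          Algebra.norm k₀ (x : k) := by
        rw [← map_mul, div_mul_cancel₀ _ x.ne_zero, Algebra.norm_eq_of_algEquiv σ (x : k)]
      rw [h1, mul_eq_right₀ (Algebra.norm_ne_zero_iff.2 x.ne_zero) |>.1 h2]
      rfl
    · rintro ⟨u, hu, rfl⟩
      -- Hilbert 90 was stated as `u·σ(y) = y`, so it is applied to the inverse to obtain `σ(y)/y =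
      -- u`.
      have hu' : Algebra.norm k₀ ((u⁻¹ : (𝓞 k)ˣ) : k) = 1 := by
        rw [← coe_unitNorm, map_inv, MonoidHom.mem_ker.1 hu]
        simp
      have hprod := norm_eq_mul_of_orderOf_eq_three σ hσ h3 ((u⁻¹ : (𝓞 k)ˣ) : k)
      rw [hu', map_one] at hprod
      obtain ⟨y, hy⟩ := exists_mul_eq_of_mul_eq_one σ h3 _ hprod.symm
      have hDy : D y = unitIncl k u := by
        have h1 : (unitIncl k u)⁻¹ * Units.map (σ : k →* k) y = y := by
          rw [← map_inv]
          exact Units.ext hy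
        rw [hD]
        change Units.map (σ : k →* k) y / y = _
        rw [div_eq_iff_eq_mul, ← inv_mul_eq_iff_eq_mul, h1]
      refine ⟨y, ?_, hDy⟩
      rw [SetLike.mem_coe, hW, Subgroup.mem_comap, hDy]
      exact ⟨u, rfl⟩
  have hP : extendedPrincipalIdeals k₀ k = D.ker.map (toPrincipalIdeal (𝓞 k) k) := by
    rw [extendedPrincipalIdeals, principalIdeals, hD, ker_fieldDiv σ hσ, MonoidHom.map_range,
      MonoidHom.map_range]
    congr 1
    ext1 x
    exact idealExt_toPrincipalIdeal k₀ k x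
  rw [← Subgroup.relIndex_map_map_of_injective _ _ unitIncl_injective, hDι, ← hWD, ← hWρ, hP,
    Subgroup.relIndex_map_map, Subgroup.relIndex_map_map, ker_toPrincipalIdeal,
    sup_eq_left.2 hEW, sup_eq_left.2 hkW, sup_comm]

end AmbiguousPrincipal

/-! ### Absolute and relative factors: the norm to `L` -/

/-- A number field `k` which is cyclic of degree three over `k₀`, together with an automorphism
`τ` that normalizes the Galois group of `k / k₀` and for which the norm to the subfield `L` is
`x ↦ x * τ x`; the base field `Q` contains the norms of `L` and of `k₀`. -/
structure CubicTower (Q k₀ L k : Type*) [Field Q] [Field k₀] [Field L] [Field k]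
    [Algebra Q L] [Algebra k₀ k] [Algebra L k] where
  σ : k ≃ₐ[k₀] k
  mem_zpowers : ∀ g, g ∈ Subgroup.zpowers σ
  orderOf_eq : orderOf σ = 3
  τ : k ≃ₐ[L] k
  τ₀ : k₀ ≃+* k₀
  τ₀_τ₀ : ∀ x, τ₀ (τ₀ x) = x
  τ_algebraMap : ∀ y : k₀, τ (algebraMap k₀ k y) = algebraMap k₀ k (τ₀ y)
  norm_eq : ∀ x : k, algebraMap L k (Algebra.norm L x) = x * τ x
  norm_of_mem_L : ∀ y : L, ∃ q : Q, algebraMap k₀ k (Algebra.norm k₀ (algebraMap L k y)) =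
    algebraMap L k (algebraMap Q L q)
  norm_of_mem_k₀ : ∀ y : k₀, ∃ q : Q, Algebra.norm L (algebraMap k₀ k y) = algebraMap Q L q
  exists_algebraMap_eq : ∀ q : Q, ∃ y : k₀, algebraMap L k (algebraMap Q L q) = algebraMap k₀ k y

namespace CubicTower

set_option linter.unusedSectionVars false

variable {Q k₀ L k : Type*} [Field Q] [NumberField Q] [Field k₀] [NumberField k₀]
  [Field L] [NumberField L] [Field k] [NumberField k]
  [Algebra Q L] [Algebra k₀ k] [Algebra L k] [IsGalois k₀ k]

/-- The conjugate of an element of the Galois group by `τ`. -/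
def conj (T : CubicTower Q k₀ L k) (g : k ≃ₐ[k₀] k) : k ≃ₐ[k₀] k :=
  AlgEquiv.ofRingEquiv (f := (T.τ.toRingEquiv.trans g.toRingEquiv).trans T.τ.symm.toRingEquiv) <| by
    intro y
    change T.τ.symm (g (T.τ (algebraMap k₀ k y))) = _
    rw [T.τ_algebraMap, g.commutes, ← T.τ_algebraMap, AlgEquiv.symm_apply_apply]

theorem τ_conj (T : CubicTower Q k₀ L k) (g : k ≃ₐ[k₀] k) (x : k) : T.τ (T.conj g x) = g (T.τ x) :=
  T.τ.apply_symm_apply _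

/-- The norm is the product of three conjugates, and each conjugate of an invariant ideal is the
ideal itself. -/
theorem pow_three_eq_of_mem_ambiguousPrincipalIdeals (T : CubicTower Q k₀ L k) (I : IdealGroup k)
    (hI : I ∈ ambiguousPrincipalIdeals k₀ k) :
    I ^ 3 = idealExt k₀ k (idealNorm k₀ k I) := by
  obtain ⟨x, rfl⟩ := hI.1
  rw [toPrincipalIdeal_mem_ambiguousPrincipalIdeals_iff] at hI
  rw [idealNorm_toPrincipalIdeal, idealExt_toPrincipalIdeal]
  have h : Units.map (algebraMap k₀ k : k₀ →* k) (Units.map (Algebra.norm k₀ : k →* k₀) x) =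
      x * Units.map (T.σ : k →* k) x * Units.map ((T.σ * T.σ : k ≃ₐ[k₀] k) : k →* k) x :=
    Units.ext (norm_eq_mul_of_orderOf_eq_three T.σ T.mem_zpowers T.orderOf_eq x)
  rw [h, map_mul, map_mul, hI, hI, pow_succ, pow_two]

theorem idealExt_idealNorm_toPrincipalIdeal (T : CubicTower Q k₀ L k) (x : kˣ) :
    idealExt L k (idealNorm L k (toPrincipalIdeal (𝓞 k) k x)) =
      toPrincipalIdeal (𝓞 k) k x * toPrincipalIdeal (𝓞 k) k (Units.map (T.τ : k →* k) x) := by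
  rw [idealNorm_toPrincipalIdeal, idealExt_toPrincipalIdeal, ← map_mul]
  congr 1
  exact Units.ext (T.norm_eq x)

theorem idealNorm_idealExt_eq_sq (T : CubicTower Q k₀ L k) (y : Lˣ) :
    idealNorm L k (idealExt L k (toPrincipalIdeal (𝓞 L) L y)) =
      toPrincipalIdeal (𝓞 L) L y ^ 2 := by
  apply idealExt_injective L k
  rw [idealExt_toPrincipalIdeal, T.idealExt_idealNorm_toPrincipalIdeal, map_pow,
    idealExt_toPrincipalIdeal, pow_two]
  congr 2
  exact Units.ext (T.τ.commutes y)

theorem toPrincipalIdeal_algebraMap_mem (q : Q) (y : Lˣ) (h : (y : L) = algebraMap Q L q) :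
    toPrincipalIdeal (𝓞 L) L y ∈ extendedPrincipalIdeals Q L := by
  have hq : q ≠ 0 := by
    rintro rfl
    exact y.ne_zero (by rw [h, map_zero])
  refine ⟨toPrincipalIdeal (𝓞 Q) Q (Units.mk0 q hq), ⟨_, rfl⟩, ?_⟩
  rw [idealExt_toPrincipalIdeal]
  congr 1
  exact Units.ext h.symm

theorem mem_absolute_iff (y : Lˣ) :
    toPrincipalIdeal (𝓞 L) L y ∈ absoluteAmbiguousPrincipalIdeals k₀ L k ↔
      idealExt L k (toPrincipalIdeal (𝓞 L) L y) ∈ ambiguousPrincipalIdeals k₀ k := by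
  constructor
  · intro h
    refine ⟨?_, h.2⟩
    rw [idealExt_toPrincipalIdeal]
    exact ⟨_, rfl⟩
  · intro h
    exact ⟨⟨y, rfl⟩, h.2⟩

theorem pow_three_mem_of_mem_absolute (T : CubicTower Q k₀ L k) (I : IdealGroup L)
    (hI : I ∈ absoluteAmbiguousPrincipalIdeals k₀ L k) :
    I ^ 3 ∈ extendedPrincipalIdeals Q L := by
  obtain ⟨y, rfl⟩ := hI.1
  have h := T.pow_three_eq_of_mem_ambiguousPrincipalIdeals _ ((mem_absolute_iff y).1 hI)
  obtain ⟨q, hq⟩ := T.norm_of_mem_L y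
  have hq0 : algebraMap Q L q ≠ 0 := by
    intro h0
    rw [h0, map_zero, map_eq_zero, Algebra.norm_eq_zero_iff, map_eq_zero] at hq
    exact y.ne_zero hq
  have : toPrincipalIdeal (𝓞 L) L y ^ 3 = toPrincipalIdeal (𝓞 L) L (Units.mk0 _ hq0) := by
    apply idealExt_injective L k
    rw [map_pow, h, idealExt_toPrincipalIdeal, idealNorm_toPrincipalIdeal,
      idealExt_toPrincipalIdeal, idealExt_toPrincipalIdeal]
    congr 1
    exact Units.ext hq
  rw [this]
  exact toPrincipalIdeal_algebraMap_mem q _ rfl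

/-- Extended back to `k`, the norm becomes `I·τ(I)`. The second factor is also invariant because `τ`
normalizes `G`. -/
theorem idealNorm_mem_absolute (T : CubicTower Q k₀ L k)
    (I : IdealGroup k) (hI : I ∈ ambiguousPrincipalIdeals k₀ k) :
    idealNorm L k I ∈ absoluteAmbiguousPrincipalIdeals k₀ L k := by
  obtain ⟨x, rfl⟩ := hI.1
  rw [idealNorm_toPrincipalIdeal, mem_absolute_iff, ← idealNorm_toPrincipalIdeal,
    T.idealExt_idealNorm_toPrincipalIdeal]
  refine mul_mem hI ?_
  rw [toPrincipalIdeal_mem_ambiguousPrincipalIdeals_iff] at hI ⊢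
  intro g
  have h1 : Units.map (g : k →* k) (Units.map (T.τ : k →* k) x) =
      Units.map (T.τ.toRingEquiv : k →* k) (Units.map (T.conj g : k →* k) x) :=
    Units.ext (T.τ_conj g x).symm
  rw [h1, ← galIdeal_toPrincipalIdeal, hI, galIdeal_toPrincipalIdeal]
  rfl

theorem extendedPrincipalIdeals_le_ambiguous :
    extendedPrincipalIdeals k₀ k ≤ ambiguousPrincipalIdeals k₀ k := by
  rintro _ ⟨_, ⟨y, rfl⟩, rfl⟩
  rw [idealExt_toPrincipalIdeal, toPrincipalIdeal_mem_ambiguousPrincipalIdeals_iff]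
  intro g
  congr 1
  exact Units.ext (g.commutes y)

theorem extendedPrincipalIdeals_le_absolute (T : CubicTower Q k₀ L k) :
    extendedPrincipalIdeals Q L ≤ absoluteAmbiguousPrincipalIdeals k₀ L k := by
  rintro _ ⟨_, ⟨q, rfl⟩, rfl⟩
  rw [idealExt_toPrincipalIdeal, mem_absolute_iff, idealExt_toPrincipalIdeal,
    toPrincipalIdeal_mem_ambiguousPrincipalIdeals_iff]
  intro g
  congr 1
  obtain ⟨y, hy⟩ := T.exists_algebraMap_eq q
  apply Units.ext
  change g (algebraMap L k (algebraMap Q L q)) = algebraMap L k (algebraMap Q L q)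
  rw [hy, g.commutes]

variable (Q L) in
/-- The ambiguous principal ideals with norm in `Q`. -/
def relativeIdeals : Subgroup (IdealGroup k) :=
  ambiguousPrincipalIdeals k₀ k ⊓ (extendedPrincipalIdeals Q L).comap (idealNorm L k)

theorem idealNorm_mem_of_mem_extendedPrincipalIdeals (T : CubicTower Q k₀ L k) (I : IdealGroup k)
    (hI : I ∈ extendedPrincipalIdeals k₀ k) : idealNorm L k I ∈ extendedPrincipalIdeals Q L := by
  obtain ⟨_, ⟨y, rfl⟩, rfl⟩ := hI
  obtain ⟨q, hq⟩ := T.norm_of_mem_k₀ y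
  rw [idealExt_toPrincipalIdeal, idealNorm_toPrincipalIdeal]
  exact toPrincipalIdeal_algebraMap_mem q _ hq

/-- This is the first isomorphism theorem for the norm to `L` modulo principal ideals of `Q`. The
point to check is surjectivity onto the absolute factors. -/
theorem relIndex_relative_mul_relIndex_absolute (T : CubicTower Q k₀ L k) :
    (extendedPrincipalIdeals k₀ k).relIndex (relativeIdeals (k₀ := k₀) (k := k) Q L) *
      (extendedPrincipalIdeals Q L).relIndex (absoluteAmbiguousPrincipalIdeals k₀ L k) =
    (extendedPrincipalIdeals k₀ k).relIndex (ambiguousPrincipalIdeals k₀ k) := by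
  have hle : extendedPrincipalIdeals k₀ k ≤ relativeIdeals (k₀ := k₀) (k := k) Q L :=
    fun I hI => ⟨extendedPrincipalIdeals_le_ambiguous hI,
      T.idealNorm_mem_of_mem_extendedPrincipalIdeals I hI⟩
  rw [← Subgroup.relIndex_mul_relIndex _ _ (ambiguousPrincipalIdeals k₀ k) hle inf_le_left]
  congr 1
  have h1 : (relativeIdeals (k₀ := k₀) (k := k) Q L).relIndex (ambiguousPrincipalIdeals k₀ k) =
      (extendedPrincipalIdeals Q L).relIndex
        ((ambiguousPrincipalIdeals k₀ k).map (idealNorm L k)) := by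
    rw [← Subgroup.relIndex_comap, relativeIdeals, Subgroup.inf_relIndex_left]
  have h2 : extendedPrincipalIdeals Q L ⊔ (ambiguousPrincipalIdeals k₀ k).map (idealNorm L k) =
      absoluteAmbiguousPrincipalIdeals k₀ L k := by
    apply le_antisymm
    · refine sup_le T.extendedPrincipalIdeals_le_absolute ?_
      rintro _ ⟨I, hI, rfl⟩
      exact T.idealNorm_mem_absolute I hI
    · intro I hI
      have h3 := T.pow_three_mem_of_mem_absolute I hI
      obtain ⟨y, rfl⟩ := hI.1
      have h4 := T.idealNorm_idealExt_eq_sq y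
      set b := toPrincipalIdeal (𝓞 L) L y
      -- Norm after extension squares `b`, and `b = b⁻³·(b²)²` with `b³` trivial modulo `Q`.
      have hb : b = (b ^ 3)⁻¹ * (idealNorm L k (idealExt L k b)) ^ 2 := by
        rw [h4, eq_inv_mul_iff_mul_eq]
        group
      rw [hb]
      exact Subgroup.mul_mem_sup (inv_mem h3)
        (pow_mem (Subgroup.mem_map_of_mem _ ((mem_absolute_iff y).1 hI)) 2)
  rw [h1, ← h2, Subgroup.relIndex_sup_left]

end CubicTower

/-! ### Auxiliary facts on groups, roots of units and involutions -/

theorem relIndex_le_card_of_ker_inf_le {G C : Type*} [CommGroup G] [Group C] [Finite C]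
    (φ : G →* C) (H K : Subgroup G) (h : φ.ker ⊓ H ≤ K) : K.relIndex H ≤ Nat.card C := by
  have h1 : φ.ker.relIndex H = Nat.card (H.map φ) := by
    rw [← MonoidHom.comap_bot, Subgroup.relIndex_comap, Subgroup.relIndex_bot_left]
  have h2 : (φ.ker ⊓ H).relIndex H = Nat.card (H.map φ) := by
    rw [Subgroup.inf_relIndex_right, h1]
  have hpos : 0 < Nat.card (H.map φ) := Nat.card_pos
  calc K.relIndex H ≤ (φ.ker ⊓ H).relIndex H :=
        Subgroup.relIndex_le_of_le_left h (by rw [h2]; exact hpos.ne')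
    _ = Nat.card (H.map φ) := h2
    _ ≤ Nat.card C := Nat.card_le_card_of_injective _ Subtype.val_injective

/-- If `xⁿ` is a unit, then `x` and `x⁻¹` are both integral. -/
theorem toPrincipalIdeal_eq_one_of_pow {F : Type*} [Field F] [NumberField F] {n : ℕ} (hn : n ≠ 0)
    {x : Fˣ} (h : toPrincipalIdeal (𝓞 F) F (x ^ n) = 1) : toPrincipalIdeal (𝓞 F) F x = 1 := by
  have hint (y : Fˣ) (hy : toPrincipalIdeal (𝓞 F) F (y ^ n) = 1) : IsIntegral ℤ (y : F) := by
    obtain ⟨u, hu⟩ := (toPrincipalIdeal_eq_one_iff _).1 hy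
    refine IsIntegral.of_pow (Nat.pos_of_ne_zero hn) ?_
    rw [← Units.val_pow_eq_pow_val, ← hu]
    exact (u : 𝓞 F).2
  have h1 := hint x h
  have h2 := hint x⁻¹ (by rw [inv_pow, map_inv, h, inv_one])
  refine (toPrincipalIdeal_eq_one_iff x).2
    ⟨⟨⟨x, h1⟩, ⟨(x⁻¹ : Fˣ), h2⟩, ?_, ?_⟩, rfl⟩
  · exact NumberField.RingOfIntegers.ext x.mul_inv
  · exact NumberField.RingOfIntegers.ext x.inv_mul

/-- A set of representatives for the nontrivial orbits of an involution of a finite set. -/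
theorem exists_half_of_involutive {α : Type*} (e : α → α) (he : ∀ x, e (e x) = x) (X : Set α)
    (hX : X.Finite) (hstab : ∀ x ∈ X, e x ∈ X) :
    ∃ Y ⊆ X, {x ∈ X | e x ≠ x}.ncard = 2 * Y.ncard ∧ (X \ e '' Y).ncard + Y.ncard = X.ncard ∧
      (∀ y ∈ Y, e y ∉ Y) ∧ ∀ x ∈ X, e x ≠ x → x ∈ Y ∨ e x ∈ Y := by
  classical
  let _ : LinearOrder α := linearOrderOfSTO WellOrderingRel
  -- An arbitrary linear order selects the smaller element of each two-element orbit.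
  let Y : Set α := {x ∈ X | x < e x}
  have hYX : Y ⊆ X := fun x hx => hx.1
  have hinj : Function.Injective e := fun a b h => by rw [← he a, h, he]
  have heY : e '' Y ⊆ X := by
    rintro _ ⟨y, hy, rfl⟩
    exact hstab y hy.1
  have hdisj : ∀ y ∈ Y, e y ∉ Y := by
    intro y hy hey
    have := hey.2
    rw [he] at this
    exact lt_asymm this hy.2
  have hunion : {x ∈ X | e x ≠ x} = Y ∪ e '' Y := by
    ext x
    constructor
    · rintro ⟨hx, hne⟩
      rcases lt_or_gt_of_ne hne with h | h
      · exact Or.inr ⟨e x, ⟨hstab x hx, by rw [he]; exact h⟩, he x⟩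
      · exact Or.inl ⟨hx, h⟩
    · rintro (hx | ⟨y, hy, rfl⟩)
      · exact ⟨hx.1, hx.2.ne'⟩
      · exact ⟨hstab y hy.1, by rw [he]; exact hy.2.ne⟩
  have hcard : (e '' Y).ncard = Y.ncard := Set.ncard_image_of_injective _ hinj
  refine ⟨Y, hYX, ?_, ?_, hdisj, ?_⟩
  · rw [hunion, Set.ncard_union_eq ?_ (hX.subset hYX) (hX.subset heY), hcard, two_mul]
    rw [Set.disjoint_left]
    rintro x hx ⟨y, hy, rfl⟩
    exact hdisj y hy hx
  · rw [← hcard, Set.ncard_sdiff_add_ncard_of_subset heY hX]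
  · intro x hx hne
    have : x ∈ Y ∪ e '' Y := hunion ▸ ⟨hx, hne⟩
    rcases this with h | ⟨y, hy, rfl⟩
    · exact Or.inl h
    · exact Or.inr (by rw [he]; exact hy)

/-! ### Bounds from orders at the ramified primes -/

namespace CubicTower

set_option linter.unusedSectionVars false

variable {Q k₀ L k : Type*} [Field Q] [NumberField Q] [Field k₀] [NumberField k₀]
  [Field L] [NumberField L] [Field k] [NumberField k]
  [Algebra Q L] [Algebra k₀ k] [Algebra L k] [IsGalois k₀ k]

/-- The action of `τ` on the primes of `k₀`. -/
def primeAut (T : CubicTower Q k₀ L k) : HeightOneSpectrum (𝓞 k₀) ≃ HeightOneSpectrum (𝓞 k₀) :=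
  HeightOneSpectrum.equivOfRingEquiv (NumberField.RingOfIntegers.mapRingEquiv T.τ₀)

theorem primeAut_primeAut (T : CubicTower Q k₀ L k)
    (v : HeightOneSpectrum (𝓞 k₀)) : T.primeAut (T.primeAut v) = v := by
  have : NumberField.RingOfIntegers.mapRingEquiv T.τ₀ =
      (NumberField.RingOfIntegers.mapRingEquiv T.τ₀).symm := by
    ext x
    change T.τ₀ x = T.τ₀.symm x
    rw [RingEquiv.eq_symm_apply, T.τ₀_τ₀]
  apply T.primeAut.symm.injective
  rw [Equiv.symm_apply_apply]
  apply HeightOneSpectrum.ext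
  change Ideal.comap _ _ = Ideal.comap _ _
  rw [← this]

variable (k₀ k) in
/-- The orders, modulo three, of the norm to `k₀` at the primes of a set. -/
def normOrd (S : Set (HeightOneSpectrum (𝓞 k₀))) :
    IdealGroup k →* Multiplicative (S → ZMod 3) where
  toFun I := Multiplicative.ofAdd fun v => (ord v.1 (idealNorm k₀ k I) : ZMod 3)
  map_one' := by
    apply Multiplicative.toAdd.injective
    ext v
    simp [ord_one]
  map_mul' I J := by
    apply Multiplicative.toAdd.injective
    ext v
    simp [ord_mul]

theorem mem_ker_normOrd (S : Set (HeightOneSpectrum (𝓞 k₀))) (I : IdealGroup k) :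
    I ∈ (normOrd k₀ k S).ker ↔ ∀ v ∈ S, (3 : ℤ) ∣ ord v (idealNorm k₀ k I) := by
  rw [MonoidHom.mem_ker]
  constructor
  · intro h v hv
    have := congrFun (congrArg Multiplicative.toAdd h) ⟨v, hv⟩
    exact (ZMod.intCast_zmod_eq_zero_iff_dvd _ 3).1 this
  · intro h
    apply Multiplicative.toAdd.injective
    ext v
    exact (ZMod.intCast_zmod_eq_zero_iff_dvd _ 3).2 (h v.1 v.2)

theorem card_multiplicative_zmod {S : Set (HeightOneSpectrum (𝓞 k₀))} (hS : S.Finite) :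
    Finite (Multiplicative (S → ZMod 3)) ∧
      Nat.card (Multiplicative (S → ZMod 3)) = 3 ^ S.ncard := by
  have : Finite S := hS
  refine ⟨inferInstanceAs (Finite (S → ZMod 3)), ?_⟩
  change Nat.card (S → ZMod 3) = _
  rw [Nat.card_fun, Nat.card_zmod, Nat.card_coe_set_eq]

/-- An ambiguous principal ideal comes from the base field if its order at the ramified primes
is trivial. -/
theorem mem_extendedPrincipalIdeals_of_dvd (T : CubicTower Q k₀ L k)
    [IsPrincipalIdealRing (𝓞 k₀)] (I : IdealGroup k)
    (hI : I ∈ ambiguousPrincipalIdeals k₀ k)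
    (h : ∀ v ∈ ramifiedPrimes k₀ k, (3 : ℤ) ∣ ord v (idealNorm k₀ k I)) :
    I ∈ extendedPrincipalIdeals k₀ k := by
  have h3 := T.pow_three_eq_of_mem_ambiguousPrincipalIdeals I hI
  obtain ⟨n, hn⟩ := toPrincipalIdeal_surjective_of_isPrincipalIdealRing (idealNorm k₀ k I)
  -- At unramified primes divisibility is automatic, since `N(I)` extends to the cube `I³`. Thus
  -- `N(I)` is a cube `(y)³` in `k₀`, and `I³ = (y)³` gives `I = (y)`.
  have hall : ∀ v, ((3 : ℕ) : ℤ) ∣ ord v (idealNorm k₀ k I) := by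
    intro v
    by_cases hv : v ∈ ramifiedPrimes k₀ k
    · exact h v hv
    · rw [← hn]
      exact dvd_ord_of_notMem_ramifiedPrimes k₀ k v hv 3 n I (by rw [hn, h3])
  obtain ⟨J, hJ⟩ := exists_pow_eq_of_dvd_ord three_ne_zero _ hall
  obtain ⟨y, rfl⟩ := toPrincipalIdeal_surjective_of_isPrincipalIdealRing J
  rw [← hJ, map_pow] at h3
  obtain ⟨x, rfl⟩ := hI.1
  refine ⟨_, ⟨y, rfl⟩, ?_⟩
  rw [idealExt_toPrincipalIdeal] at h3 ⊢
  rw [eq_comm, ← div_eq_one, ← map_div]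
  rw [← div_eq_one, ← div_pow, ← map_div, ← map_pow] at h3
  exact toPrincipalIdeal_eq_one_of_pow three_ne_zero h3

theorem primeAut_asIdeal (T : CubicTower Q k₀ L k) (v : HeightOneSpectrum (𝓞 k₀)) :
    (T.primeAut v).asIdeal =
      v.asIdeal.map (NumberField.RingOfIntegers.mapRingEquiv T.τ₀) :=
  (Ideal.map_comap_of_equiv _).symm

theorem primeAut_mem_ramifiedPrimes (T : CubicTower Q k₀ L k) (v : HeightOneSpectrum (𝓞 k₀))
    (hv : v ∈ ramifiedPrimes k₀ k) : T.primeAut v ∈ ramifiedPrimes k₀ k := by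
  obtain ⟨P, ⟨hP, hPv⟩, hram⟩ := hv
  set e := NumberField.RingOfIntegers.mapRingEquiv T.τ.toRingEquiv with he
  set e₀ := NumberField.RingOfIntegers.mapRingEquiv T.τ₀ with he₀
  have hmap (I : Ideal (𝓞 k₀)) :
      (I.map e₀).map (algebraMap (𝓞 k₀) (𝓞 k)) = (I.map (algebraMap (𝓞 k₀) (𝓞 k))).map e := by
    have hcomp : (algebraMap (𝓞 k₀) (𝓞 k)).comp (e₀ : 𝓞 k₀ →+* 𝓞 k₀) =
        (e : 𝓞 k →+* 𝓞 k).comp (algebraMap (𝓞 k₀) (𝓞 k)) := by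
      ext x
      exact (T.τ_algebraMap x).symm
    change (I.map (e₀ : 𝓞 k₀ →+* 𝓞 k₀)).map (algebraMap (𝓞 k₀) (𝓞 k)) =
      (I.map (algebraMap (𝓞 k₀) (𝓞 k))).map (e : 𝓞 k →+* 𝓞 k)
    rw [Ideal.map_map, Ideal.map_map, hcomp]
  have hle : v.asIdeal.map (algebraMap (𝓞 k₀) (𝓞 k)) ≤ P :=
    Ideal.map_le_iff_le_comap.2 hPv.over.le
  -- Ramification is recast as containment of the extended prime in `P²`, a condition that `τ`
  -- visibly transports.
  have hle2 : v.asIdeal.map (algebraMap (𝓞 k₀) (𝓞 k)) ≤ P ^ 2 := by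
    rw [← Ideal.ramificationIdx'_ne_one_iff hle,
      Ideal.ramificationIdx'_eq_ramificationIdx _ _ v.ne_bot]
    exact hram.ne'
  have hP' : (P.map e).IsPrime := Ideal.map_isPrime_of_equiv e
  have hlew : (T.primeAut v).asIdeal.map (algebraMap (𝓞 k₀) (𝓞 k)) ≤ P.map e := by
    rw [primeAut_asIdeal, hmap]
    exact Ideal.map_mono hle
  have hover : (P.map e).LiesOver (T.primeAut v).asIdeal := by
    refine ⟨(T.primeAut v).isMaximal.eq_of_le ?_ (Ideal.map_le_iff_le_comap.1 hlew)⟩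
    exact (Ideal.IsPrime.comap (algebraMap (𝓞 k₀) (𝓞 k))).ne_top
  refine ⟨P.map e, ⟨hP', hover⟩, ?_⟩
  have hne : (P.map e).ramificationIdx (𝓞 k₀) ≠ 1 := by
    rw [← Ideal.ramificationIdx'_eq_ramificationIdx _ _ (T.primeAut v).ne_bot,
      Ideal.ramificationIdx'_ne_one_iff hlew, primeAut_asIdeal, hmap, ← Ideal.map_pow]
    exact Ideal.map_mono hle2
  have hpos : 0 < (P.map e).ramificationIdx (𝓞 k₀) := Ideal.ramificationIdx_pos _ _
  omega

theorem ord_primeAut (T : CubicTower Q k₀ L k) (v : HeightOneSpectrum (𝓞 k₀)) (n : k₀ˣ) :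
    ord (T.primeAut v) (toPrincipalIdeal (𝓞 k₀) k₀ (Units.map (T.τ₀ : k₀ →* k₀) n)) =
      ord v (toPrincipalIdeal (𝓞 k₀) k₀ n) :=
  ord_equiv T.τ₀ v n

/-- The norm to `k₀` of a generator from `L` lies in `Q`, so `τ₀` fixes it. -/
theorem ord_primeAut_of_mem_absolute (T : CubicTower Q k₀ L k) (I : IdealGroup L)
    (hI : I ∈ absoluteAmbiguousPrincipalIdeals k₀ L k) (v : HeightOneSpectrum (𝓞 k₀)) :
    ord (T.primeAut v) (idealNorm k₀ k (idealExt L k I)) =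
      ord v (idealNorm k₀ k (idealExt L k I)) := by
  obtain ⟨y, rfl⟩ := hI.1
  rw [idealExt_toPrincipalIdeal, idealNorm_toPrincipalIdeal, ← T.ord_primeAut v]
  congr 2
  apply Units.ext
  obtain ⟨q, hq⟩ := T.norm_of_mem_L y
  apply (algebraMap k₀ k).injective
  change algebraMap k₀ k (Algebra.norm k₀ (algebraMap L k y)) =
    algebraMap k₀ k (T.τ₀ (Algebra.norm k₀ (algebraMap L k y)))
  rw [← T.τ_algebraMap, hq, T.τ.commutes]

/-- For a relative factor, `I·τ(I)` is generated by some `y` in `k₀`. Cubing and using `I³ = N(I)`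
gives `N(I)·τ₀(N(I)) = (y)³`; the orders of the left side are the sums in question. -/
theorem dvd_ord_add_ord_primeAut (T : CubicTower Q k₀ L k) (I : IdealGroup k)
    (hI : I ∈ relativeIdeals (k₀ := k₀) (k := k) Q L) (v : HeightOneSpectrum (𝓞 k₀)) :
    (3 : ℤ) ∣ ord (T.primeAut v) (idealNorm k₀ k I) + ord v (idealNorm k₀ k I) := by
  obtain ⟨hI, _, ⟨q, rfl⟩, hq⟩ := hI
  have h3 := T.pow_three_eq_of_mem_ambiguousPrincipalIdeals I hI
  obtain ⟨x, rfl⟩ := hI.1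
  obtain ⟨y, hy⟩ := T.exists_algebraMap_eq q
  have hy0 : y ≠ 0 := by
    rintro rfl
    rw [map_zero, map_eq_zero, map_eq_zero] at hy
    exact q.ne_zero hy
  rw [idealNorm_toPrincipalIdeal] at h3 ⊢
  set n := Units.map (Algebra.norm k₀ : k →* k₀) x with hn
  have hext := T.idealExt_idealNorm_toPrincipalIdeal x
  rw [← hq, idealExt_toPrincipalIdeal, idealExt_toPrincipalIdeal] at hext
  have hτ := congrArg (galIdeal T.τ.toRingEquiv) h3
  rw [map_pow, galIdeal_toPrincipalIdeal, idealExt_toPrincipalIdeal,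
    galIdeal_toPrincipalIdeal] at hτ
  have key : toPrincipalIdeal (𝓞 k₀) k₀ n *
      toPrincipalIdeal (𝓞 k₀) k₀ (Units.map (T.τ₀ : k₀ →* k₀) n) =
      toPrincipalIdeal (𝓞 k₀) k₀ (Units.mk0 y hy0) ^ 3 := by
    apply idealExt_injective k₀ k
    rw [map_mul, ← h3, map_pow, idealExt_toPrincipalIdeal, idealExt_toPrincipalIdeal]
    have e1 : Units.map (algebraMap k₀ k : k₀ →* k) (Units.map (T.τ₀ : k₀ →* k₀) n) =
        Units.map (T.τ.toRingEquiv : k →* k) (Units.map (algebraMap k₀ k : k₀ →* k) n) :=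
      Units.ext (T.τ_algebraMap n).symm
    have e2 : Units.map (algebraMap k₀ k : k₀ →* k) (Units.mk0 y hy0) =
        Units.map (algebraMap L k : L →* k) (Units.map (algebraMap Q L : Q →* L) q) :=
      Units.ext hy.symm
    rw [e1, e2, ← hτ, hext, mul_pow]
    rfl
  have hord := congrArg (ord (T.primeAut v)) key
  rw [ord_mul, T.ord_primeAut, ord_pow] at hord
  rw [hord]
  exact Dvd.intro _ rfl

/-- By symmetry of the orders, one prime from each `τ`-orbit detects whether the extension of `I`
comes from `k₀`. If it does, its norm `I²` is trivial modulo `Q`; so is `I³`, hence `I`. -/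
theorem relIndex_absolute_le (T : CubicTower Q k₀ L k) [IsPrincipalIdealRing (𝓞 k₀)]
    {S : Set (HeightOneSpectrum (𝓞 k₀))} (hS : S.Finite)
    (hram : ∀ v ∈ ramifiedPrimes k₀ k, v ∈ S ∨ T.primeAut v ∈ S) :
    (extendedPrincipalIdeals Q L).relIndex (absoluteAmbiguousPrincipalIdeals k₀ L k) ≤
      3 ^ S.ncard := by
  obtain ⟨hfin, hcard⟩ := card_multiplicative_zmod hS
  rw [← hcard]
  refine relIndex_le_card_of_ker_inf_le ((normOrd k₀ k S).comp (idealExt L k)) _ _ ?_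
  rintro I ⟨hker, hI⟩
  have hker' : idealExt L k I ∈ (normOrd k₀ k S).ker := hker
  rw [mem_ker_normOrd] at hker'
  have h3 := T.pow_three_mem_of_mem_absolute I hI
  have hmem : idealExt L k I ∈ extendedPrincipalIdeals k₀ k := by
    obtain ⟨y, rfl⟩ := hI.1
    refine T.mem_extendedPrincipalIdeals_of_dvd _ ((mem_absolute_iff y).1 hI) fun v hv => ?_
    rcases hram v hv with h | h
    · exact hker' v h
    · rw [← T.ord_primeAut_of_mem_absolute _ hI v]
      exact hker' _ h
  have h2 := T.idealNorm_mem_of_mem_extendedPrincipalIdeals _ hmem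
  obtain ⟨y, rfl⟩ := hI.1
  rw [T.idealNorm_idealExt_eq_sq] at h2
  have := div_mem h3 h2
  rwa [pow_succ, mul_div_cancel_left] at this

/-- Antisymmetry makes twice the order divisible by 3 at a prime fixed by `τ`, so only the moved
primes count, one for each orbit. -/
theorem relIndex_relative_le (T : CubicTower Q k₀ L k) [IsPrincipalIdealRing (𝓞 k₀)]
    {S : Set (HeightOneSpectrum (𝓞 k₀))} (hS : S.Finite)
    (hram : ∀ v ∈ ramifiedPrimes k₀ k, T.primeAut v ≠ v → v ∈ S ∨ T.primeAut v ∈ S) :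
    (extendedPrincipalIdeals k₀ k).relIndex (relativeIdeals (k₀ := k₀) (k := k) Q L) ≤
      3 ^ S.ncard := by
  obtain ⟨hfin, hcard⟩ := card_multiplicative_zmod hS
  rw [← hcard]
  refine relIndex_le_card_of_ker_inf_le (normOrd k₀ k S) _ _ ?_
  rintro I ⟨hker, hI⟩
  replace hker := (mem_ker_normOrd S I).1 hker
  refine T.mem_extendedPrincipalIdeals_of_dvd I hI.1 fun v hv => ?_
  have hadd := T.dvd_ord_add_ord_primeAut I hI v
  by_cases hne : T.primeAut v = v
  · rw [hne] at hadd
    omega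
  · rcases hram v hv hne with h | h
    · exact hker v h
    · have := hker _ h
      omega

end CubicTower

/-! ### Units over the third cyclotomic field -/

section Eisenstein

variable (K : Type*) [Field K] [NumberField K] [IsCyclotomicExtension {3} ℚ K]

theorem card_infinitePlace_eq_one : Fintype.card (NumberField.InfinitePlace K) = 1 := by
  rw [NumberField.InfinitePlace.card_eq_nrRealPlaces_add_nrComplexPlaces,
    IsCyclotomicExtension.Rat.nrRealPlaces_eq_zero (n := 3) K (by decide), zero_add,
    IsCyclotomicExtension.Rat.nrComplexPlaces_eq_totient_div_two (n := 3)]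
  rfl

theorem finite_units_and_card_le : Finite (𝓞 K)ˣ ∧ Nat.card (𝓞 K)ˣ ≤ 6 := by
  classical
  have hζ := IsCyclotomicExtension.zeta_spec 3 ℚ K
  let η : (𝓞 K)ˣ := (IsPrimitiveRoot.isUnit (hζ.toInteger_isPrimitiveRoot) (by decide)).unit
  have hmem : ∀ u : (𝓞 K)ˣ, u ∈ [1, -1, η, -η, η ^ 2, -η ^ 2] := fun u =>
    IsCyclotomicExtension.Rat.Three.Units.mem hζ u
  have hset : (Set.univ : Set (𝓞 K)ˣ) ⊆ ([1, -1, η, -η, η ^ 2, -η ^ 2].toFinset : Set (𝓞 K)ˣ) :=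
    fun u _ => by rw [Finset.mem_coe, List.mem_toFinset]; exact hmem u
  refine ⟨Set.finite_univ_iff.1 ((Finset.finite_toSet _).subset hset), ?_⟩
  rw [← Set.ncard_univ]
  refine (Set.ncard_le_ncard hset (Finset.finite_toSet _)).trans ?_
  rw [Set.ncard_coe_finset]
  exact List.toFinset_card_le _

/-- Cubes of units are norms, so the quotient is a 3-group; having at most six elements, it has
order 1 or 3. -/
theorem unitNormIndex_eq_three_pow (k : Type*) [Field k] [NumberField k] [Algebra K k]
    (h3 : Module.finrank K k = 3) : ∃ U ≤ 1, unitNormIndex K k = 3 ^ U := by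
  obtain ⟨hfin, hcard⟩ := finite_units_and_card_le K
  have hp : IsPGroup 3 ((𝓞 K)ˣ ⧸ (unitNorm K k).range) := by
    intro x
    obtain ⟨u, rfl⟩ := QuotientGroup.mk_surjective x
    refine ⟨1, ?_⟩
    rw [pow_one, ← QuotientGroup.mk_pow, QuotientGroup.eq_one_iff]
    refine ⟨unitMap K k u, ?_⟩
    apply units_ext
    rw [coe_unitNorm, coe_unitMap, Algebra.norm_algebraMap, h3]
    rfl
  have : Fact (Nat.Prime 3) := ⟨Nat.prime_three⟩
  obtain ⟨n, hn⟩ := IsPGroup.iff_card.1 hp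
  refine ⟨n, ?_, hn⟩
  have hle : Nat.card ((𝓞 K)ˣ ⧸ (unitNorm K k).range) ≤ 6 :=
    (Nat.card_le_card_of_surjective _ QuotientGroup.mk_surjective).trans hcard
  rw [hn] at hle
  by_contra! h
  have : 3 ^ 2 ≤ 3 ^ n := Nat.pow_le_pow_right (by norm_num) h
  omega

/-- Odd degree excludes ramification at infinity, so the single infinite place of `K` has three
places above it. -/
theorem rank_units_eq_two (k : Type*) [Field k] [NumberField k] [Algebra K k] [IsGalois K k]
    (h3 : Module.finrank K k = 3) : NumberField.Units.rank k = 2 := by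
  have := IsUnramifiedAtInfinitePlaces_of_odd_finrank (k := K) (K := k) (by rw [h3]; decide)
  rw [NumberField.Units.rank, IsUnramifiedAtInfinitePlaces.card_infinitePlace K k,
    card_infinitePlace_eq_one, h3]

end Eisenstein

/-! ### Split primes are those moved by `τ` -/

section Split

variable {Q k₀ L k : Type*} [Field Q] [NumberField Q] [Field k₀] [NumberField k₀]
  [Field L] [NumberField L] [Field k] [NumberField k]
  [Algebra Q L] [Algebra k₀ k] [Algebra L k] [IsGalois k₀ k]

open scoped Pointwise in
-- The Galois group of `k₀` is `{1, τ₀}` and acts transitively on the primes over a rational prime,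
-- so these are `v` and its image under `τ₀`.
theorem mem_splitPrimes_iff [IsGalois ℚ k₀] (h2 : Module.finrank ℚ k₀ = 2)
    (T : CubicTower Q k₀ L k) (hT : T.τ₀ ≠ RingEquiv.refl k₀) (v : HeightOneSpectrum (𝓞 k₀)) :
    v ∈ splitPrimes k₀ ↔ T.primeAut v ≠ v := by
  let t : k₀ ≃ₐ[ℚ] k₀ := AlgEquiv.ofRingEquiv (f := T.τ₀) fun q => by simp
  have ht : t ≠ 1 := fun h => hT (RingEquiv.ext fun x => DFunLike.congr_fun h x)
  have hcard : Nat.card (k₀ ≃ₐ[ℚ] k₀) = 2 := by rw [IsGalois.card_aut_eq_finrank, h2]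
  have hall : ∀ g : k₀ ≃ₐ[ℚ] k₀, g = 1 ∨ g = t := by
    intro g
    by_contra! h
    have : Fintype (k₀ ≃ₐ[ℚ] k₀) := Fintype.ofFinite _
    classical
    have h3 : ({1, t, g} : Finset (k₀ ≃ₐ[ℚ] k₀)).card = 3 := by
      rw [Finset.card_eq_three]
      exact ⟨1, t, g, ht.symm, h.1.symm, h.2.symm, rfl⟩
    have := Finset.card_le_univ ({1, t, g} : Finset (k₀ ≃ₐ[ℚ] k₀))
    rw [h3, ← Nat.card_eq_fintype_card, hcard] at this
    omega
  have hset : (v.asIdeal.under ℤ).primesOver (𝓞 k₀) = {v.asIdeal, (T.primeAut v).asIdeal} := by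
    have hsm : (T.primeAut v).asIdeal = t • v.asIdeal := by
      rw [T.primeAut_asIdeal]
      rfl
    ext P
    constructor
    · rintro ⟨hP, hPv⟩
      obtain ⟨g, hg⟩ := Ideal.exists_smul_eq_of_isGaloisGroup (v.asIdeal.under ℤ) v.asIdeal P
        (k₀ ≃ₐ[ℚ] k₀)
      rcases hall g with rfl | rfl
      · left
        rw [← hg, one_smul]
      · right
        rw [Set.mem_singleton_iff, hsm, hg]
    · rintro (rfl | rfl)
      · exact ⟨v.isPrime, inferInstance⟩
      · refine ⟨(T.primeAut v).isPrime, ?_⟩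
        rw [hsm]
        infer_instance
  rw [splitPrimes, Set.mem_ofPred_eq, hset, h2, Set.ncard_eq_two]
  constructor
  · rintro ⟨x, y, hxy, hs⟩ heq
    rw [heq, Set.pair_eq_singleton] at hs
    have hx : x ∈ ({v.asIdeal} : Set _) := by rw [hs]; simp
    have hy : y ∈ ({v.asIdeal} : Set _) := by rw [hs]; simp
    exact hxy (hx.trans hy.symm)
  · intro hne
    exact ⟨v.asIdeal, (T.primeAut v).asIdeal, fun h => hne (HeightOneSpectrum.ext h.symm), rfl⟩

end Split

/-! ### The pure cubic field and its normal closure -/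

section Radical

theorem pow_three_ne_of_cubefree {d : ℕ} (hd : 1 < d)
    (hcubefree : ∀ p : ℕ, p.Prime → ¬ p ^ 3 ∣ d) (q : ℚ) : q ^ 3 ≠ d := by
  intro h
  have hint : IsIntegral ℤ q := by
    refine IsIntegral.of_pow (n := 3) (by norm_num) ?_
    rw [h]
    exact map_natCast (algebraMap ℤ ℚ) d ▸ isIntegral_algebraMap
  obtain ⟨z, rfl⟩ := (IsIntegrallyClosed.isIntegral_iff (R := ℤ)).1 hint
  have hz : z.natAbs ^ 3 = d := by
    have h1 : z ^ 3 = (d : ℤ) := by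
      have : ((z ^ 3 : ℤ) : ℚ) = ((d : ℤ) : ℚ) := by push_cast; simpa using h
      exact_mod_cast this
    rw [← Int.natAbs_pow, h1, Int.natAbs_natCast]
  have hne : z.natAbs ≠ 1 := by
    intro h1
    rw [h1] at hz
    omega
  obtain ⟨p, hp, hpz⟩ := Nat.exists_prime_and_dvd hne
  exact hcubefree p hp (hz ▸ pow_dvd_pow_of_dvd hpz 3)

variable {k : Type*} [Field k] [NumberField k] {d : ℕ} {θ ζ : k}

theorem finrank_adjoin_cbrt (hθ : θ ^ 3 = (d : k)) (hcube : ∀ q : ℚ, q ^ 3 ≠ d) :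
    Module.finrank ℚ (IntermediateField.adjoin ℚ {θ}) = 3 := by
  have hirr : Irreducible (Polynomial.X ^ 3 - Polynomial.C (d : ℚ)) :=
    X_pow_sub_C_irreducible_of_prime Nat.prime_three hcube
  have hmin : minpoly ℚ θ = Polynomial.X ^ 3 - Polynomial.C (d : ℚ) := by
    refine (minpoly.eq_of_irreducible_of_monic hirr ?_
      (Polynomial.monic_X_pow_sub_C _ three_ne_zero)).symm
    simp [hθ]
  rw [IntermediateField.adjoin.finrank (Algebra.IsIntegral.isIntegral θ), hmin,
    Polynomial.natDegree_X_pow_sub_C]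

/-- The field is the splitting field of `X³ - d`: the ratio of the roots `ζθ` and `θ` recovers `ζ`.
-/
theorem isGalois_of_adjoin_eq_top (hd : d ≠ 0) (hθ : θ ^ 3 = (d : k)) (hζ : IsPrimitiveRoot ζ 3)
    (hk : IntermediateField.adjoin ℚ {θ, ζ} = ⊤) : IsGalois ℚ k := by
  have hθ0 : θ ≠ 0 := by
    rintro rfl
    rw [zero_pow three_ne_zero] at hθ
    exact hd (by exact_mod_cast hθ.symm)
  set f : Polynomial ℚ := Polynomial.X ^ 3 - Polynomial.C (d : ℚ) with hf
  have hf0 : f ≠ 0 := Polynomial.X_pow_sub_C_ne_zero (by norm_num) _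
  have hmap : f.map (algebraMap ℚ k) = Polynomial.X ^ 3 - Polynomial.C (d : k) := by
    simp [hf]
  have hsplit : (f.map (algebraMap ℚ k)).Splits := by
    rw [hmap]
    exact X_pow_sub_C_splits_of_isPrimitiveRoot hζ hθ
  have hroot (x : k) (hx : x ^ 3 = d) : x ∈ f.rootSet k := by
    rw [Polynomial.mem_rootSet]
    exact ⟨hf0, by simp [hf, hx]⟩
  have htop : IntermediateField.adjoin ℚ (f.rootSet k) = ⊤ := by
    rw [eq_top_iff, ← hk, IntermediateField.adjoin_le_iff]
    have h1 : θ ∈ IntermediateField.adjoin ℚ (f.rootSet k) :=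
      IntermediateField.subset_adjoin _ _ (hroot θ hθ)
    have h2 : ζ * θ ∈ IntermediateField.adjoin ℚ (f.rootSet k) :=
      IntermediateField.subset_adjoin _ _
        (hroot _ (by rw [mul_pow, hζ.pow_eq_one, one_mul, hθ]))
    rintro x (rfl | rfl)
    · exact h1
    · have := div_mem h2 h1
      rwa [mul_div_cancel_right₀ _ hθ0] at this
  have : Polynomial.IsSplittingField ℚ k f := by
    refine ⟨hsplit, ?_⟩
    rw [← IntermediateField.adjoin_toSubalgebra_of_isAlgebraic, htop,
      IntermediateField.top_toSubalgebra]
    exact fun x _ => Algebra.IsAlgebraic.isAlgebraic x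
  refine IsGalois.of_separable_splitting_field (p := f) ?_
  exact Polynomial.separable_X_pow_sub_C _ (by norm_num) (by exact_mod_cast hd)

end Radical

/-! ### Constructing the tower over `ℚ` -/

section Concrete

variable {k : Type*} [Field k] [NumberField k] (L k₀ : IntermediateField ℚ k)

/-- Two linearly disjoint subfields of degrees three and two give rise to a cubic tower. -/
theorem exists_cubicTower [IsGalois ℚ k] [IsGalois ℚ k₀] (hL : Module.finrank ℚ L = 3)
    (hk₀ : Module.finrank ℚ k₀ = 2) (hsup : L ⊔ k₀ = ⊤) :
    ∃ T : CubicTower ℚ k₀ L k, T.τ₀ ≠ RingEquiv.refl k₀ := by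
  have hdisj : L.LinearDisjoint k₀ := .of_finrank_coprime (by rw [hL, hk₀]; decide)
  have hdisj' : k₀.LinearDisjoint L := hdisj.symm
  have h6 : Module.finrank ℚ k = 6 := by
    have := hdisj.finrank_sup
    rw [hsup, hL, hk₀, IntermediateField.finrank_top'] at this
    exact this
  have h3 : Module.finrank k₀ k = 3 := by
    have := Module.finrank_mul_finrank ℚ k₀ k
    rw [hk₀, h6] at this
    omega
  have h2 : Module.finrank L k = 2 := by
    have := Module.finrank_mul_finrank ℚ L k
    rw [hL, h6] at this
    omega
  have hc3 : Nat.card (k ≃ₐ[k₀] k) = 3 := by rw [IsGalois.card_aut_eq_finrank, h3]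
  have hc2 : Nat.card (k ≃ₐ[L] k) = 2 := by rw [IsGalois.card_aut_eq_finrank, h2]
  have : Fact (Nat.Prime 3) := ⟨Nat.prime_three⟩
  have hcyc3 : IsCyclic (k ≃ₐ[k₀] k) := isCyclic_of_prime_card hc3
  have hcyc2 : IsCyclic (k ≃ₐ[L] k) := isCyclic_of_prime_card hc2
  obtain ⟨σ, hσ⟩ := hcyc3.exists_generator
  obtain ⟨τ, hτ⟩ := hcyc2.exists_generator
  have hoσ : orderOf σ = 3 := by rw [orderOf_eq_card_of_forall_mem_zpowers hσ, hc3]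
  have hoτ : orderOf τ = 2 := by rw [orderOf_eq_card_of_forall_mem_zpowers hτ, hc2]
  have hττ : ∀ x, τ (τ x) = x := by
    intro x
    have h : τ ^ 2 = 1 := by rw [← hoτ]; exact pow_orderOf_eq_one τ
    exact DFunLike.congr_fun h x
  let τ₀ : k₀ ≃ₐ[ℚ] k₀ := AlgEquiv.restrictNormal (τ.restrictScalars ℚ) k₀
  have hτ₀ : ∀ y : k₀, τ (algebraMap k₀ k y) = algebraMap k₀ k (τ₀ y) := fun y =>
    (AlgEquiv.restrictNormal_commutes (τ.restrictScalars ℚ) k₀ y).symm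
  have hnorm : ∀ x : k, algebraMap L k (Algebra.norm L x) = x * τ x := by
    classical
    intro x
    rw [Algebra.norm_eq_prod_automorphisms, ← IsCyclic.image_range_orderOf hτ, hoτ,
      Finset.prod_image]
    · simp [Finset.prod_range_succ]
    · intro i hi j hj hij
      exact pow_injOn_Iio_orderOf (by rw [hoτ]; simpa using hi) (by rw [hoτ]; simpa using hj) hij
  refine ⟨⟨σ, hσ, hoσ, τ, τ₀.toRingEquiv, ?_, hτ₀, hnorm, ?_, ?_, ?_⟩, ?_⟩
  · intro x
    apply (algebraMap k₀ k).injective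
    change algebraMap k₀ k (τ₀ (τ₀ x)) = _
    rw [← hτ₀, ← hτ₀, hττ]
  · intro y
    -- Linear disjointness makes the relative norm of an element of `L` equal to its norm over `ℚ`.
    obtain ⟨n, hn⟩ : ∃ n : ℚ, Algebra.norm k₀ (algebraMap L k y) = algebraMap ℚ k₀ n :=
      ⟨_, hdisj'.norm_algebraMap (by rw [sup_comm, hsup]) y⟩
    exact ⟨n, by rw [hn]; simp⟩
  · intro y
    exact ⟨Algebra.norm ℚ y, hdisj.norm_algebraMap hsup y⟩
  · intro q
    exact ⟨algebraMap ℚ k₀ q, by simp⟩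
  · intro hrefl
    have hfix : ∀ y : k₀, τ (algebraMap k₀ k y) = algebraMap k₀ k y := fun y => by
      rw [hτ₀]
      exact congrArg _ (DFunLike.congr_fun hrefl y)
    -- Were `τ₀` trivial, `τ` would fix the compositum, which is all of `k`, contradicting its order
    -- two.
    have hle : L ⊔ k₀ ≤ IntermediateField.fixedField (Subgroup.zpowers (τ.restrictScalars ℚ)) := by
      refine sup_le ?_ ?_
      · rw [IntermediateField.le_iff_le, Subgroup.zpowers_le]
        intro x
        exact τ.commutes x
      · rw [IntermediateField.le_iff_le, Subgroup.zpowers_le]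
        intro x
        exact hfix x
    have hτ1 : τ = 1 := by
      ext x
      have hx : x ∈ IntermediateField.fixedField (Subgroup.zpowers (τ.restrictScalars ℚ)) :=
        hle (hsup ▸ IntermediateField.mem_top)
      exact hx ⟨τ.restrictScalars ℚ, Subgroup.mem_zpowers _⟩
    rw [hτ1, orderOf_one] at hoτ
    omega

end Concrete

theorem rat_eq_one_or_neg_one_of_toPrincipalIdeal_eq_one (q : ℚˣ)
    (h : toPrincipalIdeal (𝓞 ℚ) ℚ q = 1) : (q : ℚ) = 1 ∨ (q : ℚ) = -1 := by
  obtain ⟨u, hu⟩ := (toPrincipalIdeal_eq_one_iff q).1 h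
  obtain ⟨z, hz⟩ := (IsIntegrallyClosed.isIntegral_iff (R := ℤ)).1 (u : 𝓞 ℚ).2
  obtain ⟨w, hw⟩ := (IsIntegrallyClosed.isIntegral_iff (R := ℤ)).1 ((u⁻¹ : (𝓞 ℚ)ˣ) : 𝓞 ℚ).2
  have hprod : z * w = 1 := by
    have h1 : (algebraMap (𝓞 ℚ) ℚ u) * algebraMap (𝓞 ℚ) ℚ (u⁻¹ : (𝓞 ℚ)ˣ) = 1 := by
      rw [← map_mul, Units.mul_inv, map_one]
    have h2 : algebraMap ℤ ℚ z * algebraMap ℤ ℚ w = 1 := by rw [hz, hw]; exact h1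
    rw [← map_mul] at h2
    exact (algebraMap ℤ ℚ).injective_int (by rw [h2, map_one])
  have hq : (q : ℚ) = z := by rw [← hu]; exact hz.symm
  rcases Int.isUnit_iff.1 (IsUnit.of_mul_eq_one w hprod) with rfl | rfl
  · left; rw [hq]; norm_num
  · right; rw [hq]; norm_num

/-! ### The factor generated by the cube root -/

section Concrete

variable {k : Type*} [Field k] [NumberField k] (L k₀ : IntermediateField ℚ k)

/-- Each conjugate of the cube root differs from it by a factor whose cube is 1, hence by a unit. -/
theorem toPrincipalIdeal_cbrt_mem [IsGalois k₀ k] {d : ℕ} (ϑ : Lˣ) (hϑ : (ϑ : L) ^ 3 = d) :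
    toPrincipalIdeal (𝓞 L) L ϑ ∈ absoluteAmbiguousPrincipalIdeals k₀ L k := by
  rw [CubicTower.mem_absolute_iff, idealExt_toPrincipalIdeal,
    toPrincipalIdeal_mem_ambiguousPrincipalIdeals_iff]
  intro g
  rw [← div_eq_one, ← map_div]
  refine toPrincipalIdeal_eq_one_of_pow three_ne_zero ?_
  rw [div_pow, ← map_pow, ← map_pow]
  have hfix : Units.map (g : k →* k) (Units.map (algebraMap L k : L →* k) (ϑ ^ 3)) =
      Units.map (algebraMap L k : L →* k) (ϑ ^ 3) := by
    apply Units.ext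
    change g (algebraMap L k ((ϑ ^ 3 : Lˣ) : L)) = algebraMap L k ((ϑ ^ 3 : Lˣ) : L)
    rw [Units.val_pow_eq_pow_val, hϑ, map_natCast, map_natCast]
  rw [hfix, div_self', map_one]

/-- If the ideal were `(q)`, cubing would give `d = ±q³`, and `-1` is itself a cube. -/
theorem toPrincipalIdeal_cbrt_notMem {d : ℕ} (hcube : ∀ q : ℚ, q ^ 3 ≠ d) (ϑ : Lˣ)
    (hϑ : (ϑ : L) ^ 3 = d) :
    toPrincipalIdeal (𝓞 L) L ϑ ∉ extendedPrincipalIdeals ℚ L := by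
  rintro ⟨_, ⟨q, rfl⟩, hq⟩
  have hd : (d : ℚ) ≠ 0 := by
    intro h0
    exact hcube 0 (by rw [h0]; norm_num)
  have hd' : Units.map (algebraMap ℚ L : ℚ →* L) (Units.mk0 (d : ℚ) hd) = ϑ ^ 3 := by
    apply Units.ext
    rw [Units.val_pow_eq_pow_val, hϑ]
    simp
  have h1 : toPrincipalIdeal (𝓞 ℚ) ℚ (Units.mk0 (d : ℚ) hd / q ^ 3) = 1 := by
    apply idealExt_injective ℚ L
    rw [map_div, map_div, map_pow, map_pow, hq, idealExt_toPrincipalIdeal, hd', map_pow, div_self',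
      map_one]
  have h2 : (Units.mk0 (d : ℚ) hd : ℚ) = ((Units.mk0 (d : ℚ) hd / q ^ 3 : ℚˣ) : ℚ) * (q : ℚ) ^ 3 := by
    rw [← Units.val_pow_eq_pow_val, ← Units.val_mul, div_mul_cancel]
  rw [Units.val_mk0] at h2
  rcases rat_eq_one_or_neg_one_of_toPrincipalIdeal_eq_one _ h1 with h | h
  · exact hcube q (by rw [h2, h, one_mul])
  · exact hcube (-q) (by rw [h2, h]; ring)

/-- Every fractional ideal of `ℚ` is principal, so the two conditions on the norm agree. -/
theorem relativeAmbiguousPrincipalIdeals_eq :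
    relativeAmbiguousPrincipalIdeals k₀ L k =
      CubicTower.relativeIdeals (k₀ := k₀) (k := k) ℚ L := by
  have hpid : IsPrincipalIdealRing (𝓞 ℚ) :=
    IsPrincipalIdealRing.of_surjective Rat.ringOfIntegersEquiv.symm
      Rat.ringOfIntegersEquiv.symm.surjective
  rw [relativeAmbiguousPrincipalIdeals, CubicTower.relativeIdeals, ← MonoidHom.comap_ker,
    QuotientGroup.ker_mk', extendedIdeals, extendedPrincipalIdeals, principalIdeals,
    MonoidHom.range_eq_top.2 toPrincipalIdeal_surjective_of_isPrincipalIdealRing,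
    MonoidHom.range_eq_map]

end Concrete

end PureCubic
end

/-! ### The classification -/

theorem theorem2p1 {k : Type*} [Field k] [NumberField k]
    (d : ℕ) (hd : 1 < d) (hcubefree : ∀ p : ℕ, p.Prime → ¬ p ^ 3 ∣ d)
    (θ ζ : k) (hθ : θ ^ 3 = (d : k)) (hζ : IsPrimitiveRoot ζ 3)
    (L k₀ : IntermediateField ℚ k)
    (hL : L = IntermediateField.adjoin ℚ {θ}) (hk₀ : k₀ = IntermediateField.adjoin ℚ {ζ})
    (hk : IntermediateField.adjoin ℚ {θ, ζ} = ⊤) :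
    ∃ U A R t s : ℕ,
      PureCubic.unitNormIndex k₀ k = 3 ^ U ∧
      Nat.card (PureCubic.AbsolutePrincipalFactors k₀ L k) = 3 ^ A ∧
      Nat.card (PureCubic.RelativePrincipalFactors k₀ L k) = 3 ^ R ∧
      (PureCubic.ramifiedPrimes k₀ k).Finite ∧
      (PureCubic.ramifiedPrimes k₀ k).ncard = t ∧
      (PureCubic.ramifiedPrimes k₀ k ∩ PureCubic.splitPrimes k₀).ncard = 2 * s ∧
      (∃! T : PureCubic.PFType, T.invariants = (U, A, R)) ∧
      A + R = U + 1 ∧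
      (1 ≤ A + R ∧ A + R ≤ t) ∧
      (1 ≤ A ∧ (A : ℤ) ≤ (t : ℤ) - (s : ℤ)) ∧
      (0 ≤ R ∧ R ≤ s) ∧
      ∃ (ϑ : Lˣ) (x : PureCubic.absoluteAmbiguousPrincipalIdeals k₀ L k),
        ((ϑ : L) : k) = θ ∧
        (x : PureCubic.IdealGroup L) = toPrincipalIdeal (𝓞 L) L ϑ ∧
        Nat.card (Subgroup.zpowers
          (QuotientGroup.mk x : PureCubic.AbsolutePrincipalFactors k₀ L k)) = 3 := by
  have hcube := PureCubic.pow_three_ne_of_cubefree hd hcubefree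
  have hL3 : Module.finrank ℚ L = 3 := by rw [hL]; exact PureCubic.finrank_adjoin_cbrt hθ hcube
  have hcyc : IsCyclotomicExtension {3} ℚ k₀ := by
    rw [hk₀]; exact hζ.intermediateField_adjoin_isCyclotomicExtension ℚ
  have hk2 : Module.finrank ℚ k₀ = 2 :=
    (IsCyclotomicExtension.finrank (n := 3) k₀
      (Polynomial.cyclotomic.irreducible_rat (by norm_num))).trans rfl
  have hsup : L ⊔ k₀ = ⊤ := by
    rw [hL, hk₀, ← IntermediateField.adjoin_union, ← hk]
    rfl
  have hgal : IsGalois ℚ k := PureCubic.isGalois_of_adjoin_eq_top (by omega) hθ hζ hk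
  have hgal₀ : IsGalois ℚ k₀ := IsCyclotomicExtension.isGalois {3} ℚ k₀
  obtain ⟨T, hT⟩ := PureCubic.exists_cubicTower L k₀ hL3 hk2 hsup
  have hpid : IsPrincipalIdealRing (𝓞 k₀) := IsCyclotomicExtension.Rat.three_pid k₀
  have h3 : Module.finrank k₀ k = 3 := by
    rw [← IsGalois.card_aut_eq_finrank, ← orderOf_eq_card_of_forall_mem_zpowers T.mem_zpowers,
      T.orderOf_eq]
  obtain ⟨U, hU1, hU⟩ := PureCubic.unitNormIndex_eq_three_pow k₀ k h3
  have hfinU := (PureCubic.finite_units_and_card_le k₀).1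
  have hcardA : Nat.card (PureCubic.AbsolutePrincipalFactors k₀ L k) =
      (PureCubic.extendedPrincipalIdeals ℚ L).relIndex
        (PureCubic.absoluteAmbiguousPrincipalIdeals k₀ L k) := rfl
  have hcardR : Nat.card (PureCubic.RelativePrincipalFactors k₀ L k) =
      (PureCubic.extendedPrincipalIdeals k₀ k).relIndex
        (PureCubic.CubicTower.relativeIdeals (k₀ := k₀) (k := k) ℚ L) := by
    rw [← PureCubic.relativeAmbiguousPrincipalIdeals_eq]; rfl
  have hmul : Nat.card (PureCubic.RelativePrincipalFactors k₀ L k) *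
      Nat.card (PureCubic.AbsolutePrincipalFactors k₀ L k) = 3 ^ (U + 1) := by
    rw [hcardA, hcardR, T.relIndex_relative_mul_relIndex_absolute,
      PureCubic.relIndex_ambiguousPrincipalIdeals T.σ T.mem_zpowers T.orderOf_eq,
      PureCubic.relIndex_range_unitDiv_ker_unitNorm T.σ T.mem_zpowers T.orderOf_eq
        (PureCubic.rank_units_eq_two k₀ k h3), hU, pow_succ, mul_comm]
  obtain ⟨A, -, hA⟩ := (Nat.dvd_prime_pow Nat.prime_three).1 (Dvd.intro_left _ hmul)
  obtain ⟨R, -, hR⟩ := (Nat.dvd_prime_pow Nat.prime_three).1 (Dvd.intro _ hmul)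
  have hsum : A + R = U + 1 := by
    rw [hA, hR, ← pow_add] at hmul
    have := Nat.pow_right_injective (by norm_num : 2 ≤ 3) hmul
    omega
  have hθ0 : θ ≠ 0 := by
    rintro rfl
    rw [zero_pow three_ne_zero] at hθ
    have : d = 0 := by exact_mod_cast hθ.symm
    omega
  have hθL : θ ∈ L := by rw [hL]; exact IntermediateField.mem_adjoin_simple_self ℚ θ
  let ϑ : Lˣ := Units.mk0 ⟨θ, hθL⟩ fun h => hθ0 (congrArg Subtype.val h)
  have hϑ : (ϑ : L) ^ 3 = d := Subtype.ext hθ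
  let x : PureCubic.absoluteAmbiguousPrincipalIdeals k₀ L k :=
    ⟨toPrincipalIdeal (𝓞 L) L ϑ, PureCubic.toPrincipalIdeal_cbrt_mem L k₀ ϑ hϑ⟩
  have horder : orderOf (QuotientGroup.mk x : PureCubic.AbsolutePrincipalFactors k₀ L k) = 3 := by
    have : Fact (Nat.Prime 3) := ⟨Nat.prime_three⟩
    refine orderOf_eq_prime ?_ ?_
    · rw [← QuotientGroup.mk_pow, QuotientGroup.eq_one_iff]
      exact T.pow_three_mem_of_mem_absolute _ x.2
    · rw [Ne, QuotientGroup.eq_one_iff]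
      exact PureCubic.toPrincipalIdeal_cbrt_notMem L hcube ϑ hϑ
  have hA1 : 1 ≤ A := by
    have hdvd := orderOf_dvd_natCard
      (QuotientGroup.mk x : PureCubic.AbsolutePrincipalFactors k₀ L k)
    rw [horder, hA] at hdvd
    by_contra! h0
    have : A = 0 := by omega
    rw [this] at hdvd
    norm_num at hdvd
  have hfin := PureCubic.ramifiedPrimes_finite k₀ k
  obtain ⟨Y, hYX, hYcard, hYcompl, hYdisj, hYcover⟩ := PureCubic.exists_half_of_involutive
    T.primeAut T.primeAut_primeAut (PureCubic.ramifiedPrimes k₀ k) hfin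
    T.primeAut_mem_ramifiedPrimes
  have hsplit : PureCubic.ramifiedPrimes k₀ k ∩ PureCubic.splitPrimes k₀ =
      {v ∈ PureCubic.ramifiedPrimes k₀ k | T.primeAut v ≠ v} := by
    ext v
    exact and_congr_right fun _ => PureCubic.mem_splitPrimes_iff hk2 T hT v
  have hRs : R ≤ Y.ncard := by
    have := T.relIndex_relative_le (hfin.subset hYX) hYcover
    rw [← hcardR, hR] at this
    exact (Nat.pow_le_pow_iff_right (by norm_num)).1 this
  -- Deleting the `τ`-image of `Y` leaves one prime from every orbit, so the count is `t - s`.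
  -- Adding `R ≤ s` also yields `A + R ≤ t`.
  have hAt : A ≤ (PureCubic.ramifiedPrimes k₀ k \ T.primeAut '' Y).ncard := by
    have := T.relIndex_absolute_le (hfin.subset Set.sdiff_subset) (S := _ \ T.primeAut '' Y)
      fun v hv => by
        by_cases hvY : v ∈ T.primeAut '' Y
        · obtain ⟨y, hy, rfl⟩ := hvY
          rw [T.primeAut_primeAut]
          refine Or.inr ⟨hYX hy, ?_⟩
          rintro ⟨z, hz, hzy⟩
          exact hYdisj z hz (hzy ▸ hy)
        · exact Or.inl ⟨hv, hvY⟩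
    rw [← hcardA, hA] at this
    exact (Nat.pow_le_pow_iff_right (by norm_num)).1 this
  refine ⟨U, A, R, _, Y.ncard, hU, hA, hR, hfin, rfl, ?_, ?_, hsum, ?_, ?_, ?_, ϑ, x, rfl, rfl, ?_⟩
  · rw [hsplit, hYcard]
  -- These are the only solutions of `A + R = U + 1` with `U ≤ 1` and `A ≥ 1`.
  · have hcases : (U = 1 ∧ A = 1 ∧ R = 1) ∨ (U = 1 ∧ A = 2 ∧ R = 0) ∨
        (U = 0 ∧ A = 1 ∧ R = 0) := by omega
    rcases hcases with ⟨rfl, rfl, rfl⟩ | ⟨rfl, rfl, rfl⟩ | ⟨rfl, rfl, rfl⟩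
    · exact ⟨.alpha, rfl, fun T' hT' => by
        cases T' <;> first | rfl | simp [PureCubic.PFType.invariants] at hT'⟩
    · exact ⟨.beta, rfl, fun T' hT' => by
        cases T' <;> first | rfl | simp [PureCubic.PFType.invariants] at hT'⟩
    · exact ⟨.gamma, rfl, fun T' hT' => by
        cases T' <;> first | rfl | simp [PureCubic.PFType.invariants] at hT'⟩
  · omega
  · omega
  · omega
  · rw [Nat.card_zpowers, horder]
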